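/- Let $(X,\mathscr A,\mu)$ be a $\sigma$-finite measure space, and let $\phi\colon X\to X$ and $w\colon X\to\mathbb C$ be $\mathscr A$-measurable. For a measurable $v\colon X\to\mathbb C$ put $\mu_v(\sigma)=\int_\sigma |v|^2\,d\mu$. If $\mu_v\circ\psi^{-1}\ll\mu$ (with $\psi\colon X\to X$ measurable), let $C_{\psi,v}$ be the operator in the complex space $L^2(\mu)$ given by $C_{\psi,v}f=v\cdot(f\circ\psi)$ on the domain $\{f\in L^2(\mu): v\cdot (f\circ\psi)\in L^2(\mu)\}$, let $h_{\psi,v}=d(\mu_v\circ\psi^{-1})/d\mu\colon X\to[0,\infty]$, and, for measurable $f\colon X\to[0,\infty]$, let $E_{\psi,v}(f)$ be the conditional expectation of $f$ with respect to the $\sigma$-algebra $\psi^{-1}(\mathscr A)$ and the measure $\mu_v$ (it exists whenever $h_{\psi,v}<\infty$ a.e. $[\mu]$, which holds in all the uses below). Put $w_0=1$ and $w_n=\prod_{j=0}^{n-1}w\circ\phi^j$ for $n\ge1$. Assume that $\mu_w\circ\phi^{-1}\ll\mu$ and that $C=C_{\phi,w}$ is a bounded operator defined on the whole of $L^2(\mu)$.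 (It is not assumed that $C$ is the product of a multiplication operator and a composition operator.) (The derivatives $h_{\phi^n,w_n}$ below then exist, because $\mu_{w_n}\circ(\phi^n)^{-1}\ll\mu$ for all $n\ge1$.) Then the following conditions are equivalent: (A) $C$ is centered, i.e. the operators $\dots,C^2C^{*2},CC^*,C^*C,C^{*2}C^2,\dots$ commute with one another; (B) for every $n\ge1$, $C_{\phi^n,w_{n,\phi}}=C_{\phi^n,w_{\phi,n}}$ (equality of operators, including domains), where $w_{n,\phi}=\dfrac{w_n}{\sqrt{h_{\phi^n,w_n}\circ\phi^n}}$ and $w_{\phi,n}=\displaystyle\prod_{j=0}^{n-1}\dfrac{w\circ\phi^{j}}{\sqrt{h_{\phi,w}\circ\phi^{j+1}}}$ (the denominators are nonzero a.e. $[\mu_{w_n}]$; the quotients are set to be $0$ where a denominator vanishes; both operators are well defined); (B$'$) for every $n\ge1$, the phase of $C^n$ is the $n$-th power of the phase of $C$, where the phase of a bounded operator $T$ is the unique partial isometry $U$ with $\ker U=\ker T$ and $T=U(T^*T)^{1/2}$; (C) for every $n\ge1$, $\prod_{j=1}^{n}h_{\phi,w}\circ\phi^{j}=h_{\phi^n,w_n}\circ\phi^n$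 a.e. $[\mu_{w_n}]$; (D) for every $n\ge1$, $h_{\phi^n,w_n}=E_{\phi,w}(h_{\phi^n,w_n})$ a.e. $[\mu_w]$; (E) for every $n\ge1$, $h_{\phi^{n+1},w_{n+1}}\circ\phi=h_{\phi^n,w_n}\cdot h_{\phi,w}\circ\phi$ a.e. $[\mu_w]$; (F) for every $n\ge1$, $h_{\phi,w}=E_{\phi^n,w_n}(h_{\phi,w})$ a.e. $[\mu_{w_n}]$; (G) for every $n\ge1$, $E_{\phi^n,w_n}(h_{\phi,w})\circ\phi=E_{\phi^{n+1},w_{n+1}}(h_{\phi,w}\circ\phi)$ a.e. $[\mu_{w_{n+1}}]$; (H) for all $n,k\ge1$, $h_{\phi^n,w_n}=E_{\phi^k,w_k}(h_{\phi^n,w_n})$ a.e. $[\mu_{w_k}]$. -/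

import Mathlib

open MeasureTheory
open scoped ENNReal

noncomputable section

namespace WCO

/-! ### Bounded operators: centered operators and phases -/

section Operators

variable {H : Type*} [NormedAddCommGroup H] [InnerProductSpace ℂ H] [CompleteSpace H]

/-- A bounded operator `T` is centered if the operators
`…, T²T²*, TT*, T*T, T²*T², …` commute with one another. -/
def IsCentered (T : H →L[ℂ] H) : Prop :=
  ∀ A ∈ {S : H →L[ℂ] H | ∃ n : ℕ, 1 ≤ n ∧ (S = T ^ n * star (T ^ n) ∨ S = star (T ^ n) * T ^ n)},
  ∀ B ∈ {S : H →L[ℂ] H | ∃ n : ℕ, 1 ≤ n ∧ (S = T ^ n * star (T ^ n) ∨ S = star (T ^ n) * T ^ n)},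
    Commute A B

/-- `U` is the phase of the bounded operator `T`: it is a partial isometry, it has the same kernel
as `T`, and `T = U |T|`, where `|T| = (T* T)^(1/2)`. These properties determine `U`. -/
structure IsPhase (U T : H →L[ℂ] H) : Prop where
  norm_map : ∀ x ∈ (LinearMap.ker (U : H →ₗ[ℂ] H))ᗮ, ‖U x‖ = ‖x‖
  ker_eq : LinearMap.ker (U : H →ₗ[ℂ] H) = LinearMap.ker (T : H →ₗ[ℂ] H)
  polar : T = U * CFC.abs T

end Operators

/-! ### Weighted composition operators -/

section Operator

variable {X : Type*} [MeasurableSpace X]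

/-- The measure `μ_w(σ) = ∫_σ |w|² dμ`. -/
def weightedMeasure (μ : Measure X) (w : X → ℂ) : Measure X :=
  μ.withDensity fun x => ‖w x‖ₑ ^ 2

/-- `φ` and `w` are measurable and `μ_w ∘ φ⁻¹` is absolutely continuous with respect to `μ`, so that
`f ↦ w · (f ∘ φ)` is a well-defined operator in `L²(μ)`. -/
structure IsWellDefined (μ : Measure X) (φ : X → X) (w : X → ℂ) : Prop where
  measurable_map : Measurable φ
  measurable_weight : Measurable w
  absolutelyContinuous : (weightedMeasure μ w).map φ ≪ μ

theorem ae_weightedMeasure_iff {μ : Measure X} {w : X → ℂ} (hw : Measurable w) {p : X → Prop} :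
    (∀ᵐ x ∂(weightedMeasure μ w), p x) ↔ ∀ᵐ x ∂μ, w x ≠ 0 → p x := by
  rw [weightedMeasure, ae_withDensity_iff (by fun_prop)]
  simp

theorem IsWellDefined.ae {μ : Measure X} {φ : X → X} {w : X → ℂ} (h : IsWellDefined μ φ w)
    {p : X → Prop} (hp : ∀ᵐ x ∂μ, p x) : ∀ᵐ x ∂μ, w x ≠ 0 → p (φ x) := by
  rw [← ae_weightedMeasure_iff h.measurable_weight (p := fun x => p (φ x))]
  exact ae_of_ae_map h.measurable_map.aemeasurable (h.absolutelyContinuous.ae_le hp)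

theorem isWellDefined_of_ae {μ : Measure X} {φ : X → X} {w : X → ℂ} (hφ : Measurable φ)
    (hw : Measurable w)
    (h : ∀ p : X → Prop, (∀ᵐ x ∂μ, p x) → ∀ᵐ x ∂μ, w x ≠ 0 → p (φ x)) :
    IsWellDefined μ φ w := by
  refine ⟨hφ, hw, Measure.AbsolutelyContinuous.mk fun s hs h0 => ?_⟩
  rw [Measure.map_apply hφ hs]
  have h1 : ∀ᵐ x ∂μ, x ∉ s := measure_eq_zero_iff_ae_notMem.1 h0
  have h2 := (ae_weightedMeasure_iff hw (p := fun x => φ x ∉ s)).2 (h _ h1)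
  exact measure_eq_zero_iff_ae_notMem.2 h2

theorem IsWellDefined.congr {μ : Measure X} {φ : X → X} {w : X → ℂ} (h : IsWellDefined μ φ w)
    {f g : X → ℂ} (hfg : f =ᵐ[μ] g) :
    (fun x => w x * f (φ x)) =ᵐ[μ] fun x => w x * g (φ x) := by
  filter_upwards [h.ae hfg] with x hx
  by_cases h0 : w x = 0
  · simp [h0]
  · rw [hx h0]

theorem IsWellDefined.add {μ : Measure X} {φ : X → X} {w : X → ℂ} (h : IsWellDefined μ φ w)
    (f g : Lp ℂ 2 μ) : (fun x => w x * (f + g : Lp ℂ 2 μ) (φ x)) =ᵐ[μ]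
      (fun x => w x * f (φ x)) + fun x => w x * g (φ x) := by
  filter_upwards [h.congr (Lp.coeFn_add f g)] with x hx
  simpa [mul_add] using hx

theorem IsWellDefined.smul {μ : Measure X} {φ : X → X} {w : X → ℂ} (h : IsWellDefined μ φ w)
    (c : ℂ) (f : Lp ℂ 2 μ) : (fun x => w x * (c • f : Lp ℂ 2 μ) (φ x)) =ᵐ[μ]
      c • fun x => w x * f (φ x) := by
  filter_upwards [h.congr (Lp.coeFn_smul c f)] with x hx
  simp only [Pi.smul_apply, smul_eq_mul] at hx ⊢
  rw [hx]; ring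

/-- The weighted composition operator `C_{φ,w} f = w · (f ∘ φ)` in `L²(μ)`, with its maximal domain
`{f ∈ L²(μ) : w · (f ∘ φ) ∈ L²(μ)}`. -/
def wco {μ : Measure X} {φ : X → X} {w : X → ℂ} (h : IsWellDefined μ φ w) :
    Lp ℂ 2 μ →ₗ.[ℂ] Lp ℂ 2 μ where
  domain :=
    { carrier := {f | MemLp (fun x => w x * f (φ x)) 2 μ}
      zero_mem' := by
        refine MemLp.ae_eq ?_ (MemLp.zero (p := 2) (μ := μ) (ε := ℂ))
        filter_upwards [h.congr (Lp.coeFn_zero ℂ 2 μ)] with x hx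
        simpa using hx.symm
      add_mem' := fun {f g} hf hg => (hf.add hg).ae_eq (h.add f g).symm
      smul_mem' := fun c f hf => (hf.const_smul c).ae_eq (h.smul c f).symm }
  toFun :=
    { toFun := fun f => MemLp.toLp (fun x => w x * (f : Lp ℂ 2 μ) (φ x)) f.2
      map_add' := fun f g => by
        rw [← MemLp.toLp_add]
        exact MemLp.toLp_congr _ _ (h.add f g)
      map_smul' := fun c f => by
        rw [RingHom.id_apply, ← MemLp.toLp_const_smul]
        exact MemLp.toLp_congr _ _ (h.smul c f) }

/-- The Radon–Nikodym derivative `h_{φ,w} = d(μ_w ∘ φ⁻¹) / dμ`. -/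
def rnd (μ : Measure X) (φ : X → X) (w : X → ℂ) : X → ℝ≥0∞ :=
  ((weightedMeasure μ w).map φ).rnDeriv μ

/-- The conditional expectation `E_{φ,w}(f)` of a `[0,∞]`-valued function `f` with respect to the
σ-algebra `φ⁻¹(𝒜)` and the measure `μ_w`. -/
def condE (μ : Measure X) (φ : X → X) (w : X → ℂ) (f : X → ℝ≥0∞) : X → ℝ≥0∞ :=
  condLExp (MeasurableSpace.comap φ inferInstance) (weightedMeasure μ w) f

/-- The weight `w_n = w · (w ∘ φ) ⋯ (w ∘ φ^(n-1))`, with `w_0 = 1`. -/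
def iterWeight (φ : X → X) (w : X → ℂ) (n : ℕ) : X → ℂ :=
  fun x => ∏ j ∈ Finset.range n, w (φ^[j] x)

/-- The Radon–Nikodym derivative `h_{φⁿ,w_n}`. -/
def rndIter (μ : Measure X) (φ : X → X) (w : X → ℂ) (n : ℕ) : X → ℝ≥0∞ :=
  rnd μ φ^[n] (iterWeight φ w n)

/-- The conditional expectation `E_{φⁿ,w_n}`. -/
def condEIter (μ : Measure X) (φ : X → X) (w : X → ℂ) (n : ℕ) (f : X → ℝ≥0∞) : X → ℝ≥0∞ :=
  condE μ φ^[n] (iterWeight φ w n) f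

/-- The measure `μ_{w_n}`. -/
def measureIter (μ : Measure X) (φ : X → X) (w : X → ℂ) (n : ℕ) : Measure X :=
  weightedMeasure μ (iterWeight φ w n)

/-- The weight `w_n / √(h_{φⁿ,w_n} ∘ φⁿ)`. The denominator vanishes only on a `μ_{w_n}`-null set;
the value there is `0`. -/
def phaseWeight (μ : Measure X) (φ : X → X) (w : X → ℂ) (n : ℕ) : X → ℂ :=
  fun x => iterWeight φ w n x / (√(rndIter μ φ w n (φ^[n] x)).toReal : ℝ)

/-- The weight `∏_{j<n} (w ∘ φ^j) / √(h_{φ,w} ∘ φ^(j+1))`. The denominator vanishes only on a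
`μ_{w_n}`-null set; the value there is `0`. -/
def powWeight (μ : Measure X) (φ : X → X) (w : X → ℂ) (n : ℕ) : X → ℂ :=
  fun x => ∏ j ∈ Finset.range n, w (φ^[j] x) / (√(rnd μ φ w (φ^[j + 1] x)).toReal : ℝ)

theorem measurable_rnd (μ : Measure X) (φ : X → X) (w : X → ℂ) : Measurable (rnd μ φ w) :=
  Measure.measurable_rnDeriv _ _

theorem measurable_iterWeight {φ : X → X} {w : X → ℂ} (hφ : Measurable φ) (hw : Measurable w)
    (n : ℕ) : Measurable (iterWeight φ w n) :=
  Finset.measurable_fun_prod _ fun j _ => hw.comp (hφ.iterate j)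

theorem IsWellDefined.ae_iterate {μ : Measure X} {φ : X → X} {w : X → ℂ}
    (h : IsWellDefined μ φ w) (n : ℕ) {p : X → Prop} (hp : ∀ᵐ x ∂μ, p x) :
    ∀ᵐ x ∂μ, iterWeight φ w n x ≠ 0 → p (φ^[n] x) := by
  induction n with
  | zero => filter_upwards [hp] with x hx _ using hx
  | succ n ih =>
    filter_upwards [h.ae ih] with x hx hne
    have e : iterWeight φ w (n + 1) x = iterWeight φ w n (φ x) * w x := by
      simp [iterWeight, Finset.prod_range_succ']
    rw [e] at hne
    exact hx (right_ne_zero_of_mul hne) (left_ne_zero_of_mul hne)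

/-- `C_{φⁿ,v}` is well defined if the weight `v` vanishes wherever `w_n` does. -/
theorem IsWellDefined.iterate_of_ne_zero {μ : Measure X} {φ : X → X} {w : X → ℂ}
    (h : IsWellDefined μ φ w) (n : ℕ) {v : X → ℂ} (hv : Measurable v)
    (hvw : ∀ x, v x ≠ 0 → iterWeight φ w n x ≠ 0) : IsWellDefined μ φ^[n] v := by
  refine isWellDefined_of_ae (h.measurable_map.iterate n) hv fun p hp => ?_
  filter_upwards [h.ae_iterate n hp] with x hx hne using hx (hvw x hne)

theorem IsWellDefined.phaseWeight {μ : Measure X} {φ : X → X} {w : X → ℂ}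
    (h : IsWellDefined μ φ w) (n : ℕ) : IsWellDefined μ φ^[n] (phaseWeight μ φ w n) := by
  refine h.iterate_of_ne_zero n ?_ fun x hx => ?_
  · refine (measurable_iterWeight h.measurable_map h.measurable_weight n).div ?_
    exact Complex.measurable_ofReal.comp (((measurable_rnd μ _ _).comp
      (h.measurable_map.iterate n)).ennreal_toReal.sqrt)
  · exact (div_ne_zero_iff.1 hx).1

theorem IsWellDefined.powWeight {μ : Measure X} {φ : X → X} {w : X → ℂ}
    (h : IsWellDefined μ φ w) (n : ℕ) : IsWellDefined μ φ^[n] (powWeight μ φ w n) := by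
  refine h.iterate_of_ne_zero n ?_ fun x hx => ?_
  · refine Finset.measurable_fun_prod _ fun j _ => ?_
    refine (h.measurable_weight.comp (h.measurable_map.iterate j)).div ?_
    exact Complex.measurable_ofReal.comp (((measurable_rnd μ _ _).comp
      (h.measurable_map.iterate (j + 1))).ennreal_toReal.sqrt)
  · refine Finset.prod_ne_zero_iff.2 fun j hj => ?_
    exact (div_ne_zero_iff.1 (Finset.prod_ne_zero_iff.1 hx j hj)).1

end Operator

end WCO

end

/-!
Write `h_n` for the derivative of `(φⁿ, w_n)`, `h = h_1`, and `E_n` for the conditional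
expectation with respect to `φⁿ` and `μ_{w_n}`. Every `h_n` is essentially bounded because `Cⁿ` is
a bounded weighted composition operator (`IsWCO.rnd_le`), so all conditional expectations are
taken with respect to σ-finite measures.

On the side of measure theory, the density of the pushforward of `f · μ_v` along `ψ`, composed
with `ψ`, is `(h_{ψ,v} ∘ ψ) · E_{ψ,v}(f)` (`IsWellDefined.density_comp_eq`). Applied to the two
factorizations `w_{n+1} = w_n · (w ∘ φⁿ) = w · (w_n ∘ φ)` it gives `h_{n+1} ∘ φ = (h ∘ φ) ·
E_1(h_n)` and `h_{n+1} ∘ φⁿ = (h_n ∘ φⁿ) · E_n(h)`. Hence `h_n = E_1(h_n)` is the recursion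
`h_{n+1} ∘ φ = h_n · (h ∘ φ)`, and `h = E_n(h)` is `h_{n+1} ∘ φⁿ = (h_n ∘ φⁿ) · h`. The recursion
expresses `h_n` through functions composed with `φ`, and iterating it through functions composed
with `φᵏ`; this is `h_n = E_k(h_n)` for all `n` and `k`. The identity `h = E_n(h)` for all `n`
telescopes to the product formula for `h_n ∘ φⁿ`. Conversely the product formula yields `h_n =
E_1(h_n)` only where `h_n ≠ 0`, and that suffices, since a function and its conditional
expectation have equal integrals (`IsWellDefined.eq_condE_of_eq_on_support`). The condition
`E_n(h) ∘ φ = E_{n+1}(h ∘ φ)` amounts to `E_n(h²) = E_n(h)²`, and a function with vanishing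
conditional variance is equal to its conditional expectation
(`IsWellDefined.eq_condE_of_condE_sq`).

On the side of operators, `C*ⁿCⁿ` is multiplication by `h_n`. An algebraic argument
(`isCentered_iff`) shows that `C` is centered if and only if each `C*ⁿCⁿ` commutes with each
`CᵏC*ᵏ`; this happens exactly if multiplication by `h_n` preserves the functions `w_k · (f ∘ φᵏ)`,
that is, if `h_n` is a function of `φᵏ` (`IsWCO.commute_iff`). The phase of `Cⁿ` is the weighted
composition operator with symbol `φⁿ` and weight `w_n / √(h_n ∘ φⁿ)` (`IsWCO.exists_phase`), while
the `n`-th power of the phase of `C` has the weight `∏_{j<n} (w ∘ φʲ) / √(h ∘ φʲ⁺¹)`. A bounded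
weighted composition operator determines its weight, so both conditions on phases say that the two
weights agree, which is the product formula.
-/

namespace WCO

/-! ### Radon–Nikodym derivatives and conditional expectations -/

section Measure

variable {X : Type*} [MeasurableSpace X] {μ : Measure X} {ψ : X → X} {v : X → ℂ}

theorem lintegral_weightedMeasure (hv : Measurable v) {f : X → ℝ≥0∞} (hf : Measurable f) :
    ∫⁻ x, f x ∂(weightedMeasure μ v) = ∫⁻ x, ‖v x‖ₑ ^ 2 * f x ∂μ := by
  rw [weightedMeasure, lintegral_withDensity_eq_lintegral_mul _ (by fun_prop) hf]
  rfl

theorem weightedMeasure_absolutelyContinuous : weightedMeasure μ v ≪ μ :=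
  withDensity_absolutelyContinuous _ _

/-- A measurable function is determined almost everywhere by its integrals against all
nonnegative measurable functions. -/
theorem ae_eq_of_forall_lintegral_mul_eq [SigmaFinite μ] {f g : X → ℝ≥0∞} (hf : Measurable f)
    (hg : Measurable g)
    (h : ∀ k : X → ℝ≥0∞, Measurable k → ∫⁻ x, f x * k x ∂μ = ∫⁻ x, g x * k x ∂μ) :
    f =ᵐ[μ] g := by
  refine ae_eq_of_forall_setLIntegral_eq_of_sigmaFinite hf hg fun s hs _ => ?_
  have := h (s.indicator 1) (measurable_one.indicator hs)
  rw [← lintegral_indicator hs, ← lintegral_indicator hs]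
  convert this using 2 <;> · ext x; by_cases hx : x ∈ s <;> simp [hx]

theorem IsWellDefined.ae_comp (h : IsWellDefined μ ψ v) {p : X → Prop} (hp : ∀ᵐ x ∂μ, p x) :
    ∀ᵐ x ∂(weightedMeasure μ v), p (ψ x) :=
  (ae_weightedMeasure_iff h.measurable_weight).2 (h.ae hp)

theorem measurable_condE (hψ : Measurable ψ) (f : X → ℝ≥0∞) : Measurable (condE μ ψ v f) :=
  (measurable_condLExp _ _ _).mono hψ.comap_le le_rfl

theorem exists_condE_eq_comp (f : X → ℝ≥0∞) :
    ∃ e : X → ℝ≥0∞, Measurable e ∧ condE μ ψ v f = e ∘ ψ :=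
  (measurable_condLExp _ _ _).exists_eq_measurable_comp

variable [SigmaFinite μ]

instance sigmaFinite_weightedMeasure : SigmaFinite (weightedMeasure μ v) :=
  SigmaFinite.withDensity_of_ne_top' fun x => by simp

theorem IsWellDefined.map_eq (h : IsWellDefined μ ψ v) :
    (weightedMeasure μ v).map ψ = μ.withDensity (rnd μ ψ v) :=
  (Measure.withDensity_rnDeriv_eq _ _ h.absolutelyContinuous).symm

theorem IsWellDefined.lintegral_comp (h : IsWellDefined μ ψ v) {f : X → ℝ≥0∞}
    (hf : Measurable f) :
    ∫⁻ x, f (ψ x) ∂(weightedMeasure μ v) = ∫⁻ x, rnd μ ψ v x * f x ∂μ := by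
  rw [← lintegral_map hf h.measurable_map, h.map_eq,
    lintegral_withDensity_eq_lintegral_mul _ (measurable_rnd _ _ _) hf]
  rfl

/-- The pushforward of `μ_v` along `ψ` charges exactly the set where the derivative is nonzero. -/
theorem IsWellDefined.ae_comp_iff (h : IsWellDefined μ ψ v) {p : X → Prop}
    (hp : MeasurableSet {x | p x}) :
    (∀ᵐ x ∂(weightedMeasure μ v), p (ψ x)) ↔ ∀ᵐ x ∂μ, rnd μ ψ v x ≠ 0 → p x := by
  rw [← ae_map_iff h.measurable_map.aemeasurable hp, h.map_eq,
    ae_withDensity_iff (measurable_rnd _ _ _)]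

theorem IsWellDefined.rnd_comp_ne_zero (h : IsWellDefined μ ψ v) :
    ∀ᵐ x ∂(weightedMeasure μ v), rnd μ ψ v (ψ x) ≠ 0 :=
  (h.ae_comp_iff (p := fun x => rnd μ ψ v x ≠ 0)
    (measurable_rnd μ ψ v (measurableSet_singleton 0).compl)).2 (by simp)

theorem IsWellDefined.sigmaFinite_trim (h : IsWellDefined μ ψ v)
    (hfin : ∀ᵐ x ∂μ, rnd μ ψ v x ≠ ∞) :
    SigmaFinite ((weightedMeasure μ v).trim h.measurable_map.comap_le) := by
  refine SigmaFinite.of_map (f := ψ) _ (comap_measurable ψ).aemeasurable ?_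
  rw [map_trim_comap h.measurable_map, h.map_eq]
  exact SigmaFinite.withDensity_of_ne_top hfin

theorem IsWellDefined.lintegral_condE (h : IsWellDefined μ ψ v)
    (hfin : ∀ᵐ x ∂μ, rnd μ ψ v x ≠ ∞) {f g : X → ℝ≥0∞} (hf : Measurable f) (hg : Measurable g) :
    ∫⁻ x, condE μ ψ v f x * g (ψ x) ∂(weightedMeasure μ v) =
      ∫⁻ x, f x * g (ψ x) ∂(weightedMeasure μ v) := by
  have := h.sigmaFinite_trim hfin
  have hc : Measurable (condE μ ψ v f) := measurable_condE h.measurable_map f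
  have key : ((weightedMeasure μ v).withDensity (condE μ ψ v f)).map ψ =
      ((weightedMeasure μ v).withDensity f).map ψ := by
    ext s hs
    rw [Measure.map_apply h.measurable_map hs, Measure.map_apply h.measurable_map hs,
      withDensity_apply _ (h.measurable_map hs), withDensity_apply _ (h.measurable_map hs)]
    exact setLIntegral_condLExp h.measurable_map.comap_le _ f ⟨s, hs, rfl⟩
  have e := congrArg (fun ν => ∫⁻ x, g x ∂ν) key
  simp only [lintegral_map hg h.measurable_map] at e
  have hgψ : Measurable fun x => g (ψ x) := hg.comp h.measurable_map
  rwa [lintegral_withDensity_eq_lintegral_mul _ hc hgψ,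
    lintegral_withDensity_eq_lintegral_mul _ hf hgψ] at e

theorem IsWellDefined.condE_of_ae_eq_comp (h : IsWellDefined μ ψ v)
    (hfin : ∀ᵐ x ∂μ, rnd μ ψ v x ≠ ∞) {f g : X → ℝ≥0∞} (hg : Measurable g)
    (hfg : ∀ᵐ x ∂(weightedMeasure μ v), f x = g (ψ x)) :
    ∀ᵐ x ∂(weightedMeasure μ v), f x = condE μ ψ v f x := by
  have := h.sigmaFinite_trim hfin
  have h1 : condE μ ψ v f =ᵐ[weightedMeasure μ v] condE μ ψ v (g ∘ ψ) := condLExp_congr_ae hfg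
  have h2 : condE μ ψ v (g ∘ ψ) = g ∘ ψ :=
    condLExp_eq_self _ _ (hg.comp (comap_measurable ψ))
  filter_upwards [hfg, h1] with x hx hx1
  rw [hx1, h2, hx]; rfl

/-- The density `F` of the pushforward of `f · μ_v` along `ψ` is `h_{ψ,v}` times the conditional
expectation of `f`. -/
theorem IsWellDefined.density_comp_eq (h : IsWellDefined μ ψ v)
    (hfin : ∀ᵐ x ∂μ, rnd μ ψ v x ≠ ∞) {f F : X → ℝ≥0∞} (hf : Measurable f) (hF : Measurable F)
    (hfF : ∀ g : X → ℝ≥0∞, Measurable g →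
      ∫⁻ x, f x * g (ψ x) ∂(weightedMeasure μ v) = ∫⁻ x, F x * g x ∂μ) :
    ∀ᵐ x ∂(weightedMeasure μ v), F (ψ x) = rnd μ ψ v (ψ x) * condE μ ψ v f x := by
  obtain ⟨e, he, hce⟩ := exists_condE_eq_comp (μ := μ) (ψ := ψ) (v := v) f
  have : F =ᵐ[μ] fun x => rnd μ ψ v x * e x := by
    refine ae_eq_of_forall_lintegral_mul_eq hF ((measurable_rnd _ _ _).mul he) fun g hg => ?_
    rw [← hfF g hg, ← h.lintegral_condE hfin hf hg, hce]
    simpa [mul_assoc] using h.lintegral_comp (he.mul hg)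
  filter_upwards [h.ae_comp this] with x hx
  rw [hx, hce]; rfl

/-- A strictly positive function on `X` whose pullback along `ψ` is `μ_v`-integrable. -/
theorem IsWellDefined.exists_pos_lintegral_comp_ne_top (h : IsWellDefined μ ψ v) {K : ℝ≥0∞}
    (hK : K ≠ ∞) (hle : ∀ᵐ x ∂μ, rnd μ ψ v x ≤ K) :
    ∃ ρ : X → ℝ≥0∞, Measurable ρ ∧ (∀ x, ρ x ≠ 0) ∧ (∀ x, ρ x ≠ ∞) ∧
      ∫⁻ x, ρ (ψ x) ∂(weightedMeasure μ v) ≠ ∞ := by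
  obtain ⟨ρ, hpos, hm, hρ⟩ := exists_pos_lintegral_lt_of_sigmaFinite μ one_ne_zero
  refine ⟨fun x => ρ x, by fun_prop, fun x => by simpa using (hpos x).ne', fun x => by simp, ?_⟩
  rw [h.lintegral_comp (f := fun x => (ρ x : ℝ≥0∞)) (by fun_prop)]
  refine ne_top_of_le_ne_top (ENNReal.mul_ne_top hK (hρ.trans ENNReal.one_lt_top).ne) ?_
  rw [← lintegral_const_mul _ (by fun_prop)]
  exact lintegral_mono_ae (hle.mono fun x hx => by gcongr)

/-- If `f` agrees with its conditional expectation wherever `f` is nonzero, then it agrees with it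
everywhere: the two functions have the same integrals, and one dominates the other. -/
theorem IsWellDefined.eq_condE_of_eq_on_support (h : IsWellDefined μ ψ v) {K L : ℝ≥0∞}
    (hK : K ≠ ∞) (hL : L ≠ ∞) (hle : ∀ᵐ x ∂μ, rnd μ ψ v x ≤ K) {f : X → ℝ≥0∞}
    (hf : Measurable f) (hfL : ∀ᵐ x ∂(weightedMeasure μ v), f x ≤ L)
    (hsupp : ∀ᵐ x ∂(weightedMeasure μ v), f x ≠ 0 → f x = condE μ ψ v f x) :
    ∀ᵐ x ∂(weightedMeasure μ v), f x = condE μ ψ v f x := by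
  have hfin : ∀ᵐ x ∂μ, rnd μ ψ v x ≠ ∞ := hle.mono fun x hx => ne_top_of_le_ne_top hK hx
  have hψ : Measurable ψ := h.measurable_map
  obtain ⟨ρ, hρ, h0, htop, hint⟩ := h.exists_pos_lintegral_comp_ne_top hK hle
  have hρψ : Measurable fun x => ρ (ψ x) := hρ.comp h.measurable_map
  have key := ae_eq_of_ae_le_of_lintegral_le (μ := weightedMeasure μ v)
    (f := fun x => f x * ρ (ψ x)) (g := fun x => condE μ ψ v f x * ρ (ψ x)) ?_ ?_
    ((measurable_condE h.measurable_map f).mul hρψ).aemeasurable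
    (h.lintegral_condE hfin hf hρ).le
  · filter_upwards [key] with x hx
    exact (ENNReal.mul_left_inj (h0 _) (htop _)).1 hx
  · filter_upwards [hsupp] with x hx
    by_cases hx0 : f x = 0
    · simp [hx0]
    · rw [← hx hx0]
  · refine ne_top_of_le_ne_top (ENNReal.mul_ne_top hL hint) ?_
    rw [← lintegral_const_mul _ hρψ]
    exact lintegral_mono_ae (hfL.mono fun x hx => by gcongr)

/-- A bounded function with vanishing conditional variance agrees with its conditional
expectation. -/
theorem IsWellDefined.eq_condE_of_condE_sq (h : IsWellDefined μ ψ v) {K L : ℝ≥0∞}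
    (hK : K ≠ ∞) (hL : L ≠ ∞) (hle : ∀ᵐ x ∂μ, rnd μ ψ v x ≤ K) {f : X → ℝ≥0∞}
    (hf : Measurable f) (hfL : ∀ᵐ x ∂(weightedMeasure μ v), f x ≤ L)
    (hvar : ∀ᵐ x ∂(weightedMeasure μ v),
      condE μ ψ v (fun y => f y ^ 2) x = condE μ ψ v f x ^ 2) :
    ∀ᵐ x ∂(weightedMeasure μ v), f x = condE μ ψ v f x := by
  have hfin : ∀ᵐ x ∂μ, rnd μ ψ v x ≠ ∞ := hle.mono fun x hx => ne_top_of_le_ne_top hK hx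
  have hψ : Measurable ψ := h.measurable_map
  obtain ⟨ρ, hρ, h0, htop, hint⟩ := h.exists_pos_lintegral_comp_ne_top hK hle
  have hρψ : Measurable fun x => ρ (ψ x) := hρ.comp h.measurable_map
  obtain ⟨e, he, hce⟩ := exists_condE_eq_comp (μ := μ) (ψ := ψ) (v := v) f
  have heψ : Measurable fun x => e (ψ x) := he.comp h.measurable_map
  set ν := weightedMeasure μ v
  -- `f²`, `f · (e ∘ ψ)` and `(e ∘ ψ)²` have the same integral against `ρ ∘ ψ`.
  have i1 : ∫⁻ x, f x ^ 2 * ρ (ψ x) ∂ν = ∫⁻ x, e (ψ x) ^ 2 * ρ (ψ x) ∂ν := by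
    rw [← h.lintegral_condE hfin (hf.pow_const 2) hρ]
    refine lintegral_congr_ae (hvar.mono fun x hx => ?_)
    dsimp only; rw [hx, hce]; rfl
  have i2 : ∫⁻ x, f x * e (ψ x) * ρ (ψ x) ∂ν = ∫⁻ x, e (ψ x) ^ 2 * ρ (ψ x) ∂ν := by
    have := h.lintegral_condE hfin hf (he.mul hρ)
    rw [hce] at this
    simpa [mul_assoc, sq] using this.symm
  have i3 : ∫⁻ x, f x ^ 2 * ρ (ψ x) ∂ν ≠ ∞ := by
    refine ne_top_of_le_ne_top (ENNReal.mul_ne_top (ENNReal.pow_ne_top hL (n := 2)) hint) ?_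
    rw [← lintegral_const_mul _ hρψ]
    exact lintegral_mono_ae (hfL.mono fun x hx => by gcongr)
  have hefin : ∀ᵐ x ∂ν, e (ψ x) ≠ ∞ := by
    have := ae_lt_top' ((heψ.pow_const 2).mul hρψ).aemeasurable (i1 ▸ i3)
    filter_upwards [this] with x hx hx'
    simp [hx', ENNReal.top_mul (h0 (ψ x))] at hx
  set d : X → ℝ≥0∞ := fun x => (f x - e (ψ x)) ^ 2 + (e (ψ x) - f x) ^ 2 with hd_def
  have hd : Measurable d := by fun_prop
  have expand : ∀ᵐ x ∂ν, f x ^ 2 * ρ (ψ x) + e (ψ x) ^ 2 * ρ (ψ x) =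
      2 * (f x * e (ψ x) * ρ (ψ x)) + d x * ρ (ψ x) := by
    filter_upwards [hefin, hfL] with x hx1 hx2
    have hx2 := ne_top_of_le_ne_top hL hx2
    simp only [hd_def]
    generalize f x = a at *
    generalize e (ψ x) = b at *
    rw [← add_mul, ← mul_assoc, ← add_mul]
    congr 1
    lift a to NNReal using hx2
    lift b to NNReal using hx1
    norm_cast
    rcases le_total a b with hab | hab
    · obtain ⟨c, rfl⟩ := exists_add_of_le hab
      simp [tsub_eq_zero_of_le hab]; ring
    · obtain ⟨c, rfl⟩ := exists_add_of_le hab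
      simp [tsub_eq_zero_of_le hab]; ring
  have hzero : ∫⁻ x, d x * ρ (ψ x) ∂ν = 0 := by
    have := lintegral_congr_ae expand
    rw [lintegral_add_left (by fun_prop), lintegral_add_left (by fun_prop),
      lintegral_const_mul _ (by fun_prop), i2, ← i1, ← two_mul] at this
    have hne : 2 * ∫⁻ x, f x ^ 2 * ρ (ψ x) ∂ν ≠ ∞ := ENNReal.mul_ne_top (by simp) i3
    exact (ENNReal.add_right_inj hne).1 (by rw [← this, add_zero])
  rw [lintegral_eq_zero_iff (by fun_prop)] at hzero
  filter_upwards [hzero] with x hx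
  have hx : d x = 0 := (mul_eq_zero.1 hx).resolve_right (h0 _)
  simp only [hd_def, add_eq_zero, ne_eq, OfNat.ofNat_ne_zero, not_false_eq_true,
    pow_eq_zero_iff, tsub_eq_zero_iff_le] at hx
  rw [hce]
  exact le_antisymm hx.1 hx.2

end Measure

/-! ### Iterated weights and the derivatives of iterates -/

theorem iterWeight_succ' {X : Type*} (φ : X → X) (w : X → ℂ) (n : ℕ) (x : X) :
    iterWeight φ w (n + 1) x = w x * iterWeight φ w n (φ x) := by
  simp [iterWeight, Finset.prod_range_succ', mul_comm]

theorem iterWeight_succ {X : Type*} (φ : X → X) (w : X → ℂ) (n : ℕ) (x : X) :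
    iterWeight φ w (n + 1) x = iterWeight φ w n x * w (φ^[n] x) := by
  simp [iterWeight, Finset.prod_range_succ]

theorem iterWeight_one {X : Type*} (φ : X → X) (w : X → ℂ) : iterWeight φ w 1 = w := by
  ext x; simp [iterWeight]

theorem prod_Icc_one_eq_prod_range {M : Type*} [CommMonoid M] (f : ℕ → M) (n : ℕ) :
    ∏ j ∈ Finset.Icc 1 n, f j = ∏ j ∈ Finset.range n, f (j + 1) := by
  induction n with
  | zero => simp
  | succ n ih => rw [Finset.prod_Icc_succ_top (by omega), Finset.prod_range_succ, ih]

section Iterate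

variable {X : Type*} [MeasurableSpace X] {μ : Measure X} {φ : X → X} {w : X → ℂ}

theorem measureIter_one (μ : Measure X) (φ : X → X) (w : X → ℂ) :
    measureIter μ φ w 1 = weightedMeasure μ w := by
  rw [measureIter, iterWeight_one]

theorem rndIter_one (μ : Measure X) (φ : X → X) (w : X → ℂ) :
    rndIter μ φ w 1 = rnd μ φ w := by
  rw [rndIter, iterWeight_one]; rfl

theorem measurable_rndIter (μ : Measure X) (φ : X → X) (w : X → ℂ) (n : ℕ) :
    Measurable (rndIter μ φ w n) :=
  measurable_rnd _ _ _

theorem IsWellDefined.iterate (h : IsWellDefined μ φ w) (n : ℕ) :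
    IsWellDefined μ φ^[n] (iterWeight φ w n) :=
  h.iterate_of_ne_zero n (measurable_iterWeight h.measurable_map h.measurable_weight n)
    fun _ hx => hx

theorem IsWellDefined.ae_measureIter_iff (h : IsWellDefined μ φ w) {n : ℕ} {p : X → Prop} :
    (∀ᵐ x ∂(measureIter μ φ w n), p x) ↔ ∀ᵐ x ∂μ, iterWeight φ w n x ≠ 0 → p x :=
  ae_weightedMeasure_iff (h.iterate n).measurable_weight

theorem IsWellDefined.ae_measureIter_comp (h : IsWellDefined μ φ w) {n : ℕ} {p : X → Prop}
    (hp : ∀ᵐ x ∂(measureIter μ φ w n), p x) : ∀ᵐ x ∂(measureIter μ φ w (n + 1)), p (φ x) := by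
  rw [h.ae_measureIter_iff] at hp ⊢
  filter_upwards [h.ae hp] with x hx hne
  rw [iterWeight_succ'] at hne
  exact hx (left_ne_zero_of_mul hne) (right_ne_zero_of_mul hne)

theorem IsWellDefined.ae_measureIter_comp_iterate (h : IsWellDefined μ φ w) (n : ℕ) {p : X → Prop}
    (hp : ∀ᵐ x ∂(weightedMeasure μ w), p x) :
    ∀ᵐ x ∂(measureIter μ φ w (n + 1)), p (φ^[n] x) := by
  rw [ae_weightedMeasure_iff h.measurable_weight] at hp
  rw [h.ae_measureIter_iff]
  filter_upwards [h.ae_iterate n hp] with x hx hne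
  rw [iterWeight_succ] at hne
  exact hx (left_ne_zero_of_mul hne) (right_ne_zero_of_mul hne)

theorem IsWellDefined.ae_measureIter_mono (h : IsWellDefined μ φ w) {m n : ℕ} (hmn : m ≤ n)
    {p : X → Prop} (hp : ∀ᵐ x ∂(measureIter μ φ w m), p x) :
    ∀ᵐ x ∂(measureIter μ φ w n), p x := by
  rw [h.ae_measureIter_iff] at hp ⊢
  filter_upwards [hp] with x hx hne
  refine hx fun h0 => hne ?_
  obtain ⟨i, hi, hi0⟩ := Finset.prod_eq_zero_iff.1 h0
  exact Finset.prod_eq_zero (Finset.range_subset_range.2 hmn hi) hi0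

theorem IsWellDefined.ae_rndIter_comp_ne_top (h : IsWellDefined μ φ w) (n : ℕ)
    (hfin : ∀ᵐ x ∂μ, rndIter μ φ w n x ≠ ∞) :
    ∀ᵐ x ∂(measureIter μ φ w n), rndIter μ φ w n (φ^[n] x) ≠ ∞ :=
  (h.iterate n).ae_comp hfin

variable [SigmaFinite μ]

theorem IsWellDefined.lintegral_measureIter_comp (h : IsWellDefined μ φ w) (n : ℕ)
    {f : X → ℝ≥0∞} (hf : Measurable f) :
    ∫⁻ x, f (φ x) ∂(measureIter μ φ w (n + 1)) =
      ∫⁻ x, rnd μ φ w x * f x ∂(measureIter μ φ w n) := by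
  have hφ := h.measurable_map
  have hw := h.measurable_weight
  have hwn := (h.iterate n).measurable_weight
  have hr := measurable_rnd μ φ w
  rw [measureIter, measureIter, lintegral_weightedMeasure (h.iterate (n + 1)).measurable_weight
    (by fun_prop), lintegral_weightedMeasure hwn (by fun_prop)]
  calc _ = ∫⁻ x, ‖iterWeight φ w n (φ x)‖ₑ ^ 2 * f (φ x) ∂(weightedMeasure μ w) := by
        rw [lintegral_weightedMeasure hw (by fun_prop)]
        simp only [iterWeight_succ', enorm_mul, mul_pow, mul_assoc]
    _ = _ := by
        rw [h.lintegral_comp (f := fun x => ‖iterWeight φ w n x‖ₑ ^ 2 * f x) (by fun_prop)]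
        simp only [mul_left_comm]

theorem IsWellDefined.lintegral_measureIter_comp_iterate (h : IsWellDefined μ φ w) (n : ℕ)
    {f : X → ℝ≥0∞} (hf : Measurable f) :
    ∫⁻ x, f (φ^[n] x) ∂(measureIter μ φ w (n + 1)) =
      ∫⁻ x, rndIter μ φ w n x * f x ∂(weightedMeasure μ w) := by
  have hφ := (h.iterate n).measurable_map
  have hw := h.measurable_weight
  have hwn := (h.iterate n).measurable_weight
  have hr := measurable_rndIter μ φ w n
  rw [measureIter, lintegral_weightedMeasure (h.iterate (n + 1)).measurable_weight
    (by fun_prop), lintegral_weightedMeasure hw (by fun_prop)]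
  calc _ = ∫⁻ x, ‖w (φ^[n] x)‖ₑ ^ 2 * f (φ^[n] x) ∂(measureIter μ φ w n) := by
        rw [measureIter, lintegral_weightedMeasure hwn (by fun_prop)]
        simp only [iterWeight_succ, enorm_mul, mul_pow, mul_assoc]
    _ = _ := by
        rw [measureIter, (h.iterate n).lintegral_comp (f := fun x => ‖w x‖ₑ ^ 2 * f x)
          (by fun_prop)]
        simp only [rndIter, mul_left_comm]

theorem IsWellDefined.ae_rndIter_comp_ne_zero (h : IsWellDefined μ φ w) (n : ℕ) :
    ∀ᵐ x ∂(measureIter μ φ w n), rndIter μ φ w n (φ^[n] x) ≠ 0 :=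
  (h.iterate n).rnd_comp_ne_zero

/-- The factorization `w_{n+1} = w · (w_n ∘ φ)` read through the derivatives. -/
theorem IsWellDefined.rndIter_succ_comp_iterate (h : IsWellDefined μ φ w) (n : ℕ)
    (hfin : ∀ᵐ x ∂μ, rndIter μ φ w n x ≠ ∞) :
    ∀ᵐ x ∂(measureIter μ φ w n), rndIter μ φ w (n + 1) (φ^[n] x) =
      rndIter μ φ w n (φ^[n] x) * condEIter μ φ w n (rnd μ φ w) x := by
  refine (h.iterate n).density_comp_eq hfin (measurable_rnd _ _ _)
    (measurable_rndIter _ _ _ _) fun g hg => ?_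
  have h1 := h.lintegral_measureIter_comp n (hg.comp (h.iterate n).measurable_map)
  have h2 := (h.iterate (n + 1)).lintegral_comp hg
  exact h1.symm.trans h2

/-- The factorization `w_{n+1} = w_n · (w ∘ φⁿ)` read through the derivatives. -/
theorem IsWellDefined.rndIter_succ_comp (h : IsWellDefined μ φ w) (n : ℕ)
    (hfin : ∀ᵐ x ∂μ, rnd μ φ w x ≠ ∞) :
    ∀ᵐ x ∂(weightedMeasure μ w), rndIter μ φ w (n + 1) (φ x) =
      rnd μ φ w (φ x) * condE μ φ w (rndIter μ φ w n) x := by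
  refine h.density_comp_eq hfin (measurable_rndIter _ _ _ _)
    (measurable_rndIter _ _ _ _) fun g hg => ?_
  have h1 := h.lintegral_measureIter_comp_iterate n (hg.comp h.measurable_map)
  have h2 := (h.iterate (n + 1)).lintegral_comp hg
  simp only [Function.iterate_succ_apply'] at h2
  exact h1.symm.trans h2

end Iterate

/-! ### Equivalence of the measure-theoretic conditions -/

section Conditions

variable {X : Type*} [MeasurableSpace X] {μ : Measure X} {φ : X → X} {w : X → ℂ}

/-- All derivatives `h_{φⁿ,w_n}` are essentially bounded. -/
def HasBoundedDerivs (μ : Measure X) (φ : X → X) (w : X → ℂ) : Prop :=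
  ∀ n : ℕ, ∃ K : ℝ≥0∞, K ≠ ∞ ∧ ∀ᵐ x ∂μ, rndIter μ φ w n x ≤ K

theorem HasBoundedDerivs.ae_ne_top (hb : HasBoundedDerivs μ φ w) (n : ℕ) :
    ∀ᵐ x ∂μ, rndIter μ φ w n x ≠ ∞ := by
  obtain ⟨K, hK, hle⟩ := hb n
  exact hle.mono fun x hx => ne_top_of_le_ne_top hK hx

theorem HasBoundedDerivs.rnd_ne_top (hb : HasBoundedDerivs μ φ w) : ∀ᵐ x ∂μ, rnd μ φ w x ≠ ∞ :=
  rndIter_one μ φ w ▸ hb.ae_ne_top 1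

variable [SigmaFinite μ]

theorem IsWellDefined.eq_condE_iff (h : IsWellDefined μ φ w) (hb : HasBoundedDerivs μ φ w)
    (n : ℕ) :
    (∀ᵐ x ∂(weightedMeasure μ w), rndIter μ φ w n x = condE μ φ w (rndIter μ φ w n) x) ↔
      ∀ᵐ x ∂(weightedMeasure μ w),
        rndIter μ φ w (n + 1) (φ x) = rndIter μ φ w n x * rnd μ φ w (φ x) := by
  refine Filter.eventually_congr ?_
  filter_upwards [h.rndIter_succ_comp n hb.rnd_ne_top, h.rnd_comp_ne_zero,
    h.ae_comp hb.rnd_ne_top] with x h1 h2 h3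
  rw [h1, mul_comm, ENNReal.mul_left_inj h2 h3, eq_comm]

theorem IsWellDefined.eq_condEIter_iff (h : IsWellDefined μ φ w) (hb : HasBoundedDerivs μ φ w)
    (n : ℕ) :
    (∀ᵐ x ∂(measureIter μ φ w n), rnd μ φ w x = condEIter μ φ w n (rnd μ φ w) x) ↔
      ∀ᵐ x ∂(measureIter μ φ w n),
        rndIter μ φ w (n + 1) (φ^[n] x) = rndIter μ φ w n (φ^[n] x) * rnd μ φ w x := by
  refine Filter.eventually_congr ?_
  filter_upwards [h.rndIter_succ_comp_iterate n (hb.ae_ne_top n), h.ae_rndIter_comp_ne_zero n,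
    h.ae_rndIter_comp_ne_top n (hb.ae_ne_top n)] with x h1 h2 h3
  rw [h1, ENNReal.mul_right_inj h2 h3, eq_comm]

/-- Every `h_{φⁿ,w_n}` is a function of `φᵏ`: the recursion gives `h_n = (h_{n+1} / h_1) ∘ φ`, and
both functions on the right can be expanded again. -/
theorem IsWellDefined.exists_rndIter_eq_comp (h : IsWellDefined μ φ w)
    (hb : HasBoundedDerivs μ φ w)
    (hE : ∀ n : ℕ, 1 ≤ n → ∀ᵐ x ∂(weightedMeasure μ w),
      rndIter μ φ w (n + 1) (φ x) = rndIter μ φ w n x * rnd μ φ w (φ x))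
    {k : ℕ} (hk : 1 ≤ k) : ∀ n : ℕ, 1 ≤ n → ∃ g : X → ℝ≥0∞, Measurable g ∧
      ∀ᵐ x ∂(measureIter μ φ w k), rndIter μ φ w n x = g (φ^[k] x) := by
  have key : ∀ n : ℕ, 1 ≤ n → ∀ᵐ x ∂(measureIter μ φ w 1),
      rndIter μ φ w n x = rndIter μ φ w (n + 1) (φ x) / rndIter μ φ w 1 (φ x) := by
    intro n hn
    rw [measureIter_one, rndIter_one]
    filter_upwards [hE n hn, h.rnd_comp_ne_zero, h.ae_comp hb.rnd_ne_top] with x h1 h2 h3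
    rw [h1, ENNReal.mul_div_cancel_right h2 h3]
  induction k, hk using Nat.le_induction with
  | base =>
    intro n hn
    exact ⟨_, (measurable_rndIter μ φ w (n + 1)).div (measurable_rndIter μ φ w 1), key n hn⟩
  | succ k hk ih =>
    intro n hn
    obtain ⟨g₁, hg₁, h₁⟩ := ih (n + 1) (by omega)
    obtain ⟨g₂, hg₂, h₂⟩ := ih 1 le_rfl
    refine ⟨_, hg₁.div hg₂, ?_⟩
    filter_upwards [h.ae_measureIter_mono (by omega : 1 ≤ k + 1) (key n hn),
      h.ae_measureIter_comp h₁, h.ae_measureIter_comp h₂] with x e0 e1 e2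
    rw [e0, e1, e2]; rfl

theorem IsWellDefined.eq_condEIter_rndIter (h : IsWellDefined μ φ w)
    (hb : HasBoundedDerivs μ φ w)
    (hE : ∀ n : ℕ, 1 ≤ n → ∀ᵐ x ∂(weightedMeasure μ w),
      rndIter μ φ w (n + 1) (φ x) = rndIter μ φ w n x * rnd μ φ w (φ x))
    (n k : ℕ) (hn : 1 ≤ n) (hk : 1 ≤ k) : ∀ᵐ x ∂(measureIter μ φ w k),
      rndIter μ φ w n x = condEIter μ φ w k (rndIter μ φ w n) x := by
  obtain ⟨g, hg, hgn⟩ := h.exists_rndIter_eq_comp hb hE hk n hn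
  exact (h.iterate k).condE_of_ae_eq_comp (hb.ae_ne_top k) hg hgn

theorem IsWellDefined.prod_rnd_eq (h : IsWellDefined μ φ w) (hb : HasBoundedDerivs μ φ w)
    (hF : ∀ n : ℕ, 1 ≤ n → ∀ᵐ x ∂(measureIter μ φ w n),
      rnd μ φ w x = condEIter μ φ w n (rnd μ φ w) x)
    (n : ℕ) (hn : 1 ≤ n) : ∀ᵐ x ∂(measureIter μ φ w n),
      ∏ j ∈ Finset.Icc 1 n, rnd μ φ w (φ^[j] x) = rndIter μ φ w n (φ^[n] x) := by
  induction n, hn using Nat.le_induction with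
  | base => simp [rndIter_one]
  | succ n hn ih =>
    filter_upwards [h.ae_measureIter_comp ih,
      h.ae_measureIter_comp ((h.eq_condEIter_iff hb n).1 (hF n hn))] with x h1 h2
    rw [Function.iterate_succ_apply, h2, ← h1, prod_Icc_one_eq_prod_range,
      prod_Icc_one_eq_prod_range, Finset.prod_range_succ']
    rfl

/-- The product formula, taken for `n + 1` and `n`, shows that `h_n` agrees with its conditional
expectation on its support, which is enough. -/
theorem IsWellDefined.eq_condE_of_prod_rnd_eq (h : IsWellDefined μ φ w)
    (hb : HasBoundedDerivs μ φ w)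
    (hC : ∀ n : ℕ, 1 ≤ n → ∀ᵐ x ∂(measureIter μ φ w n),
      ∏ j ∈ Finset.Icc 1 n, rnd μ φ w (φ^[j] x) = rndIter μ φ w n (φ^[n] x))
    (n : ℕ) (hn : 1 ≤ n) : ∀ᵐ x ∂(weightedMeasure μ w),
      rndIter μ φ w n x = condE μ φ w (rndIter μ φ w n) x := by
  obtain ⟨K, hK, hle⟩ := hb 1
  obtain ⟨L, hL, hleL⟩ := hb n
  rw [rndIter_one] at hle
  refine h.eq_condE_of_eq_on_support hK hL hle (measurable_rndIter _ _ _ _)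
    (weightedMeasure_absolutelyContinuous.ae_le hleL) ?_
  -- The identity to be shown holds after composition with `φⁿ`, and `h_n` is the density of
  -- the pushforward of `μ_{w_n}` along `φⁿ`.
  have hcomp : ∀ᵐ x ∂(measureIter μ φ w (n + 1)),
      rndIter μ φ w n (φ^[n] x) = condE μ φ w (rndIter μ φ w n) (φ^[n] x) := by
    filter_upwards [hC (n + 1) (by omega), h.ae_measureIter_mono n.le_succ (hC n hn),
      h.ae_measureIter_comp_iterate n (h.rndIter_succ_comp n hb.rnd_ne_top),
      h.ae_measureIter_comp_iterate n h.rnd_comp_ne_zero,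
      h.ae_measureIter_comp_iterate n (h.ae_comp hb.rnd_ne_top)] with x h1 h2 h3 h4 h5
    rw [Finset.prod_Icc_succ_top (by omega), h2, Function.iterate_succ_apply', h3, mul_comm] at h1
    exact (ENNReal.mul_right_inj h4 h5).1 h1
  rw [h.ae_measureIter_iff] at hcomp
  rw [ae_weightedMeasure_iff h.measurable_weight]
  have hmeas : MeasurableSet {y | w y ≠ 0 →
      rndIter μ φ w n y = condE μ φ w (rndIter μ φ w n) y} := by
    have e1 := measurableSet_eq_fun (measurable_rndIter μ φ w n)
      (measurable_condE (μ := μ) (v := w) h.measurable_map (rndIter μ φ w n))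
    have e2 := h.measurable_weight (measurableSet_singleton 0)
    convert e2.union e1 using 1
    ext y; simp [imp_iff_not_or]
  have := ((h.iterate n).ae_comp_iff hmeas).1 (by
    rw [ae_weightedMeasure_iff (h.iterate n).measurable_weight]
    filter_upwards [hcomp] with x hx hne hne'
    exact hx (by rw [iterWeight_succ]; exact mul_ne_zero hne hne'))
  filter_upwards [this] with x hx h1 h2 using hx h2 h1

theorem IsWellDefined.condEIter_comp_eq (h : IsWellDefined μ φ w) (hb : HasBoundedDerivs μ φ w)
    (n : ℕ) (hF : ∀ᵐ x ∂(measureIter μ φ w n),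
      rnd μ φ w x = condEIter μ φ w n (rnd μ φ w) x) :
    ∀ᵐ x ∂(measureIter μ φ w (n + 1)), condEIter μ φ w n (rnd μ φ w) (φ x) =
      condEIter μ φ w (n + 1) (fun y => rnd μ φ w (φ y)) x := by
  obtain ⟨e, he, hce⟩ := exists_condE_eq_comp (μ := μ) (ψ := φ^[n]) (v := iterWeight φ w n)
    (rnd μ φ w)
  have h1 := h.ae_measureIter_comp hF
  have h2 := (h.iterate (n + 1)).condE_of_ae_eq_comp (hb.ae_ne_top (n + 1))
    (f := fun y => rnd μ φ w (φ y)) he (h1.mono fun x hx => by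
      rw [hx, condEIter, hce]; rfl)
  filter_upwards [h1, h2] with x hx1 hx2
  rw [← hx1, hx2]; rfl

/-- If conditioning commutes with the composition by `φ`, then the conditional variance of `h_{φ,w}`
vanishes. -/
theorem IsWellDefined.eq_condEIter_of_comp_eq (h : IsWellDefined μ φ w)
    (hb : HasBoundedDerivs μ φ w) (n : ℕ)
    (hG : ∀ᵐ x ∂(measureIter μ φ w (n + 1)), condEIter μ φ w n (rnd μ φ w) (φ x) =
      condEIter μ φ w (n + 1) (fun y => rnd μ φ w (φ y)) x) :
    ∀ᵐ x ∂(measureIter μ φ w n), rnd μ φ w x = condEIter μ φ w n (rnd μ φ w) x := by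
  have hφ := h.measurable_map
  have hr := measurable_rnd μ φ w
  obtain ⟨K, hK, hle⟩ := hb n
  obtain ⟨L, hL, hleL⟩ := hb 1
  rw [rndIter_one] at hleL
  have hleL' : ∀ᵐ x ∂(measureIter μ φ w n), rnd μ φ w x ≤ L :=
    weightedMeasure_absolutelyContinuous.ae_le hleL
  have hfin := hb.ae_ne_top n
  have hin := h.iterate n
  obtain ⟨a, ha, hca⟩ := exists_condE_eq_comp (μ := μ) (ψ := φ^[n]) (v := iterWeight φ w n)
    (rnd μ φ w)
  obtain ⟨b, hbm, hcb⟩ := exists_condE_eq_comp (μ := μ) (ψ := φ^[n]) (v := iterWeight φ w n)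
    (fun y => rnd μ φ w y ^ 2)
  refine hin.eq_condE_of_condE_sq hK hL hle hr hleL' ?_
  have hrn := measurable_rndIter μ φ w n
  -- `h_{n+1}` is `h_n` times the conditional expectation of `h_1`.
  have hsucc : rndIter μ φ w (n + 1) =ᵐ[μ] fun x => rndIter μ φ w n x * a x := by
    refine ae_eq_of_forall_lintegral_mul_eq (measurable_rndIter _ _ _ _) (hrn.mul ha)
      fun g hg => ?_
    have h1 := h.lintegral_measureIter_comp n (hg.comp hin.measurable_map)
    have h2 := (h.iterate (n + 1)).lintegral_comp hg
    have h3 := hin.lintegral_condE hfin hr hg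
    have h4 := hin.lintegral_comp (ha.mul hg)
    rw [hca] at h3
    simp only [mul_assoc]
    exact h2.symm.trans (h1.trans (h3.symm.trans h4))
  -- The density of the pushforward of `(h_1 ∘ φ) · μ_{w_{n+1}}` along `φⁿ⁺¹`.
  have hdens := (h.iterate (n + 1)).density_comp_eq (hb.ae_ne_top (n + 1))
    (f := fun y => rnd μ φ w (φ y)) (F := fun x => rndIter μ φ w n x * b x) (hr.comp hφ)
    (hrn.mul hbm) (fun g hg => by
      have h1 := h.lintegral_measureIter_comp n (hr.mul (hg.comp hin.measurable_map))
      have h3 := hin.lintegral_condE hfin (hr.pow_const 2) hg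
      have h4 := hin.lintegral_comp (hbm.mul hg)
      rw [hcb] at h3
      simp only [Pi.mul_apply, ← mul_assoc, ← sq, Function.comp_apply] at h1 h4
      exact h1.trans (h3.symm.trans h4))
  have hcomp : ∀ᵐ x ∂(measureIter μ φ w (n + 1)), b (φ^[n + 1] x) = a (φ^[n + 1] x) ^ 2 := by
    filter_upwards [hdens, hG, (h.iterate (n + 1)).ae_comp hsucc,
      h.ae_measureIter_comp (h.ae_rndIter_comp_ne_zero n),
      h.ae_measureIter_comp (h.ae_rndIter_comp_ne_top n hfin)] with x h1 h2 h3 h4 h5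
    have h1 : rndIter μ φ w n (φ^[n + 1] x) * b (φ^[n + 1] x) =
      rndIter μ φ w (n + 1) (φ^[n + 1] x) *
        condEIter μ φ w (n + 1) (fun y => rnd μ φ w (φ y)) x := h1
    rw [← h2, h3, condEIter, hca, mul_assoc] at h1
    rw [sq]
    exact (ENNReal.mul_right_inj h4 h5).1 h1
  have hae := ((h.iterate (n + 1)).ae_comp_iff
    (measurableSet_eq_fun hbm (ha.pow_const 2))).1 hcomp
  -- Where the conditional expectation of `h_1` vanishes, so does that of `h_1 ^ 2`.
  have hdom : ∀ᵐ x ∂(measureIter μ φ w n), b (φ^[n] x) ≤ L * a (φ^[n] x) := by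
    have m1 : condE μ φ^[n] (iterWeight φ w n) (fun y => rnd μ φ w y ^ 2)
        ≤ᵐ[measureIter μ φ w n] condE μ φ^[n] (iterWeight φ w n) (L • rnd μ φ w) :=
      condLExp_mono (hleL'.mono fun x hx => by
        simp only [sq, Pi.smul_apply, smul_eq_mul]; gcongr)
    have m2 : condE μ φ^[n] (iterWeight φ w n) (L • rnd μ φ w) =ᵐ[measureIter μ φ w n]
        L • condE μ φ^[n] (iterWeight φ w n) (rnd μ φ w) := condLExp_smul' _ hL
    filter_upwards [m1, m2] with x h1 h2
    rw [h2, hca, hcb] at h1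
    exact h1
  filter_upwards [hin.ae_comp hae, hin.ae_comp hsucc, hdom, h.ae_rndIter_comp_ne_zero n]
    with x h1 h2 h3 h4
  rw [hca, hcb]
  simp only [Function.comp_apply]
  by_cases ha0 : a (φ^[n] x) = 0
  · rw [ha0, mul_zero] at h3
    rw [ha0, le_antisymm h3 zero_le]; simp
  · exact h1 (by change rndIter μ φ w (n + 1) (φ^[n] x) ≠ 0; rw [h2]; exact mul_ne_zero h4 ha0)

end Conditions

/-! ### Phases and centered operators -/

section Hilbert

variable {H : Type*} [NormedAddCommGroup H] [InnerProductSpace ℂ H]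

theorem ker_eq_of_norm_eq {S T : H →L[ℂ] H} (h : ∀ x, ‖S x‖ = ‖T x‖) :
    LinearMap.ker (S : H →ₗ[ℂ] H) = LinearMap.ker (T : H →ₗ[ℂ] H) := by
  ext x
  change S x = 0 ↔ T x = 0
  rw [← norm_eq_zero, h x, norm_eq_zero]

variable [CompleteSpace H]

theorem isSelfAdjoint_of_inner {M : H →L[ℂ] H} (h : ∀ x y, inner ℂ (M x) y = inner ℂ x (M y)) :
    IsSelfAdjoint M :=
  (ContinuousLinearMap.eq_adjoint_iff M M).2 h |>.symm

theorem star_mul_self_eq_of_norm_eq {S T : H →L[ℂ] H} (h : ∀ x, ‖S x‖ = ‖T x‖) :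
    star S * S = star T * T := by
  apply ContinuousLinearMap.coe_injective
  refine (ext_inner_map _ _).1 fun x => ?_
  have e : ∀ R : H →L[ℂ] H, inner ℂ ((star R * R) x) x = ((‖R x‖ : ℂ)) ^ 2 := by
    intro R
    rw [ContinuousLinearMap.star_eq_adjoint, mul_apply_eq_comp,
      ContinuousLinearMap.adjoint_inner_left, inner_self_eq_norm_sq_to_K]
    rfl
  exact (e S).trans ((by rw [h x]) : _ = _) |>.trans (e T).symm

theorem norm_abs_apply (T : H →L[ℂ] H) (x : H) : ‖CFC.abs T x‖ = ‖T x‖ := by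
  have e : ∀ R : H →L[ℂ] H, RCLike.re (inner ℂ ((star R * R) x) x) = ‖R x‖ ^ 2 := by
    intro R
    rw [ContinuousLinearMap.star_eq_adjoint, mul_apply_eq_comp,
      ContinuousLinearMap.adjoint_inner_left, inner_self_eq_norm_sq]
  have hs : star (CFC.abs T) = CFC.abs T := (CFC.abs_nonneg T).isSelfAdjoint
  have h1 := e (CFC.abs T)
  rw [hs, CFC.abs_mul_abs, e T] at h1
  exact ((sq_eq_sq₀ (norm_nonneg _) (norm_nonneg _)).1 h1).symm

theorem IsPhase.unique {U V T : H →L[ℂ] H} (hU : IsPhase U T) (hV : IsPhase V T) : U = V := by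
  set K := LinearMap.ker ((U - V : H →L[ℂ] H) : H →ₗ[ℂ] H) with hK
  have hclosed : IsClosed (K : Set H) := (U - V).isClosed_ker
  have hmem : ∀ x, x ∈ K ↔ U x = V x := fun x => by
    rw [hK, LinearMap.mem_ker]
    exact sub_eq_zero
  -- `K` contains the range of `|T|` and its orthogonal complement.
  have hrange : ∀ x, CFC.abs T x ∈ K := fun x => by
    have h1 := congrArg (fun S : H →L[ℂ] H => S x) hU.polar
    have h2 := congrArg (fun S : H →L[ℂ] H => S x) hV.polar
    exact (hmem _).2 (h1.symm.trans h2)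
  have hperp : Kᗮ ≤ K := fun y hy => by
    have h0 : CFC.abs T y = 0 := by
      refine ext_inner_left ℂ fun x => ?_
      have hs : star (CFC.abs T) = CFC.abs T := (CFC.abs_nonneg T).isSelfAdjoint
      have h1 := (Submodule.mem_orthogonal _ _).1 hy _ (hrange x)
      rw [inner_zero_right, ← h1, ← ContinuousLinearMap.adjoint_inner_left,
        ← ContinuousLinearMap.star_eq_adjoint, hs]
    have hT : y ∈ LinearMap.ker (T : H →ₗ[ℂ] H) := by
      change T y = 0
      rw [← norm_eq_zero, ← norm_abs_apply, h0, norm_zero]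
    have h1 : y ∈ LinearMap.ker (U : H →ₗ[ℂ] H) := hU.ker_eq.symm ▸ hT
    have h2 : y ∈ LinearMap.ker (V : H →ₗ[ℂ] H) := hV.ker_eq.symm ▸ hT
    exact (hmem y).2 ((show U y = 0 from h1).trans (show V y = 0 from h2).symm)
  have hbot : Kᗮ = ⊥ := by
    rw [eq_bot_iff, ← K.inf_orthogonal_eq_bot]
    exact le_inf hperp le_rfl
  have : CompleteSpace K := hclosed.completeSpace_coe
  have htop : K = ⊤ := Submodule.orthogonal_eq_bot_iff.1 hbot
  ext x
  exact (hmem x).1 (htop ▸ Submodule.mem_top)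

/-- A criterion for `U` to be the phase of `T` in which `|T|` is given as a positive operator `M`
with `‖M x‖ = ‖T x‖`. -/
theorem isPhase_of_factorization {U T M N : H →L[ℂ] H} (hMN : M = star N * N)
    (hnorm : ∀ x, ‖M x‖ = ‖T x‖) (hker : ∀ x, U x = 0 ↔ T x = 0) (hT : ∀ x, T x = U (M x)) :
    IsPhase U T := by
  have hpos : 0 ≤ M := hMN ▸ star_mul_self_nonneg N
  have hs : star M = M := hpos.isSelfAdjoint
  have habs : CFC.abs T = M := by
    refine CFC.sqrt_unique ?_ hpos
    rw [← star_mul_self_eq_of_norm_eq hnorm, hs]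
  have hkerUT : LinearMap.ker (U : H →ₗ[ℂ] H) = LinearMap.ker (T : H →ₗ[ℂ] H) := by
    ext x; exact hker x
  refine ⟨fun x hx => ?_, hkerUT, ?_⟩
  · rw [hkerUT, ← ker_eq_of_norm_eq hnorm, ContinuousLinearMap.orthogonal_ker,
      ← ContinuousLinearMap.star_eq_adjoint, hs] at hx
    have hx : x ∈ closure (Set.range M) := hx
    refine closure_minimal (t := {y | ‖U y‖ = ‖y‖}) ?_ (isClosed_eq (by fun_prop) (by fun_prop)) hx
    rintro _ ⟨y, rfl⟩
    change ‖U (M y)‖ = ‖M y‖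
    rw [← hT, hnorm]
  · ext x
    rw [habs]
    exact hT x

/-- When the operators `T*ⁿTⁿ` commute with one another, `T` is centered as soon as they commute
with the operators `TᵏT*ᵏ`. -/
theorem isCentered_iff {T : H →L[ℂ] H}
    (hcomm : ∀ m n : ℕ, Commute (star (T ^ m) * T ^ m) (star (T ^ n) * T ^ n)) :
    IsCentered T ↔ ∀ n k : ℕ, 1 ≤ n → 1 ≤ k →
      Commute (star (T ^ n) * T ^ n) (T ^ k * star (T ^ k)) := by
  refine ⟨fun h n k hn hk => h _ ⟨n, hn, Or.inr rfl⟩ _ ⟨k, hk, Or.inl rfl⟩, fun h => ?_⟩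
  -- `TⁿT*ⁿ` and `TⁿTᵏT*ᵏT*ⁿ` commute because `T*ⁿTⁿ` and `TᵏT*ᵏ` do.
  have hadd : ∀ n k : ℕ, 1 ≤ n →
      Commute (T ^ n * star (T ^ n)) (T ^ (n + k) * star (T ^ (n + k))) := by
    intro n k hn
    rcases Nat.eq_zero_or_pos k with rfl | hk
    · exact Commute.refl _
    · have e := (h n k hn hk).eq
      rw [Commute, SemiconjBy, pow_add, star_mul]
      calc _ = T ^ n * ((star (T ^ n) * T ^ n) * (T ^ k * star (T ^ k))) * star (T ^ n) := by
            simp only [mul_assoc]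
        _ = _ := by rw [e]; simp only [mul_assoc]
  have hright : ∀ m n : ℕ, 1 ≤ m → 1 ≤ n →
      Commute (T ^ m * star (T ^ m)) (T ^ n * star (T ^ n)) := by
    intro m n hm hn
    rcases le_total m n with hmn | hmn
    · obtain ⟨k, rfl⟩ := exists_add_of_le hmn
      exact hadd m k hm
    · obtain ⟨k, rfl⟩ := exists_add_of_le hmn
      exact (hadd n k hn).symm
  rintro A ⟨m, hm, rfl | rfl⟩ B ⟨n, hn, rfl | rfl⟩
  · exact hright m n hm hn
  · exact (h n m hn hm).symm
  · exact h m n hm hn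
  · exact hcomm m n

/-- If `S` maps the range of `T` into itself through a self-adjoint `G`, it commutes with `TT*`. -/
theorem commute_mul_star_of_intertwine {S T G : H →L[ℂ] H} (hS : IsSelfAdjoint S)
    (hG : IsSelfAdjoint G) (h : S * T = T * G) : Commute S (T * star T) := by
  have h' : star T * S = G * star T := by
    have := congrArg star h
    rwa [star_mul, star_mul, hS.star_eq, hG.star_eq] at this
  rw [Commute, SemiconjBy, ← mul_assoc, h, mul_assoc, mul_assoc, h']

end Hilbert

/-! ### Bounded weighted composition operators -/

section Bounded

variable {X : Type*} [MeasurableSpace X] {μ : Measure X} {ψ : X → X} {v : X → ℂ}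

/-- The bounded operator `T` is the weighted composition operator `f ↦ v · (f ∘ ψ)`, defined on all
of `L²(μ)`. Multiplication operators are the case `ψ = id`. -/
def IsWCO (μ : Measure X) (ψ : X → X) (v : X → ℂ) (T : Lp ℂ 2 μ →L[ℂ] Lp ℂ 2 μ) : Prop :=
  ∀ f : Lp ℂ 2 μ, T f =ᵐ[μ] fun x => v x * f (ψ x)

theorem isWCO_of_wco_eq {h : IsWellDefined μ ψ v} {T : Lp ℂ 2 μ →L[ℂ] Lp ℂ 2 μ}
    (hT : wco h = (T : Lp ℂ 2 μ →ₗ[ℂ] Lp ℂ 2 μ).toPMap ⊤) : IsWCO μ ψ v T := by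
  intro f
  obtain ⟨hd, hv⟩ := LinearPMap.ext_iff.1 hT
  have hf : f ∈ (wco h).domain := hd ▸ Submodule.mem_top
  have e : MemLp.toLp _ hf = T f := @hv f hf Submodule.mem_top
  rw [← e]
  exact MemLp.coeFn_toLp _

theorem eLpNorm_two_sq (f : X → ℂ) : eLpNorm f 2 μ ^ 2 = ∫⁻ x, ‖f x‖ₑ ^ 2 ∂μ := by
  rw [eLpNorm_eq_lintegral_rpow_enorm_toReal (by simp) (by simp), ← ENNReal.rpow_natCast,
    ← ENNReal.rpow_mul]
  simp

theorem Lp_enorm_sq (f : Lp ℂ 2 μ) : ‖f‖ₑ ^ 2 = ∫⁻ x, ‖f x‖ₑ ^ 2 ∂μ := by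
  rw [Lp.enorm_def, eLpNorm_two_sq]

theorem IsWCO.mul {ψ' : X → X} {v' : X → ℂ} {T T' : Lp ℂ 2 μ →L[ℂ] Lp ℂ 2 μ}
    (h : IsWellDefined μ ψ v) (hT : IsWCO μ ψ v T) (hT' : IsWCO μ ψ' v' T') :
    IsWCO μ (ψ' ∘ ψ) (fun x => v x * v' (ψ x)) (T * T') := by
  intro f
  have h1 := (hT (T' f)).trans (h.congr (hT' f))
  filter_upwards [h1] with x hx
  rw [mul_apply_eq_comp, hx, mul_assoc]; rfl

theorem IsWCO.pow {φ : X → X} {w : X → ℂ} {C : Lp ℂ 2 μ →L[ℂ] Lp ℂ 2 μ}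
    (h : IsWellDefined μ φ w) (hC : IsWCO μ φ w C) (n : ℕ) :
    IsWCO μ φ^[n] (iterWeight φ w n) (C ^ n) := by
  induction n with
  | zero => intro f; simp [iterWeight]
  | succ n ih =>
    have := hC.mul h ih
    rw [pow_succ', Function.iterate_succ]
    convert this using 2 with x
    exact iterWeight_succ' _ _ _ x

theorem IsWCO.congr_weight {v' : X → ℂ} {T : Lp ℂ 2 μ →L[ℂ] Lp ℂ 2 μ}
    (hT : IsWCO μ ψ v T) (hv : v =ᵐ[μ] v') : IsWCO μ ψ v' T := fun f => by
  filter_upwards [hT f, hv] with x h1 h2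
  rw [h1, h2]

theorem IsWCO.unique {T T' : Lp ℂ 2 μ →L[ℂ] Lp ℂ 2 μ}
    (hT : IsWCO μ ψ v T) (hT' : IsWCO μ ψ v T') : T = T' := by
  ext1 f
  exact Lp.ext ((hT f).trans (hT' f).symm)

theorem isWellDefined_id {v : X → ℂ} (hv : Measurable v) : IsWellDefined μ id v :=
  ⟨measurable_id, hv, by
    rw [Measure.map_id]; exact weightedMeasure_absolutelyContinuous⟩

theorem isSelfAdjoint_of_isWCO_id {r : X → ℝ} {M : Lp ℂ 2 μ →L[ℂ] Lp ℂ 2 μ}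
    (hM : IsWCO μ id (fun x => (r x : ℂ)) M) : IsSelfAdjoint M := by
  refine isSelfAdjoint_of_inner fun f g => ?_
  rw [L2.inner_def, L2.inner_def]
  refine integral_congr_ae ?_
  filter_upwards [hM f, hM g] with x h1 h2
  rw [h1, h2]
  simp [mul_left_comm, mul_assoc]

/-- The values of a weighted composition operator at one function that vanishes almost nowhere
determine its weight. -/
theorem IsWellDefined.weight_ae_eq {v' : X → ℂ} (h : IsWellDefined μ ψ v)
    (h' : IsWellDefined μ ψ v') {f : Lp ℂ 2 μ} (hf : ∀ᵐ x ∂μ, f x ≠ 0)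
    (heq : (fun x => v x * f (ψ x)) =ᵐ[μ] fun x => v' x * f (ψ x)) : v =ᵐ[μ] v' := by
  filter_upwards [heq, h.ae hf, h'.ae hf] with x h1 h2 h3
  by_cases hx : v x = 0
  · by_cases hx' : v' x = 0
    · rw [hx, hx']
    · exact mul_right_cancel₀ (h3 hx') h1
  · exact mul_right_cancel₀ (h2 hx) h1

variable [SigmaFinite μ]

theorem exists_Lp_ae_ne_zero (μ : Measure X) [SigmaFinite μ] :
    ∃ f : Lp ℂ 2 μ, ∀ᵐ x ∂μ, f x ≠ 0 := by
  obtain ⟨ρ, hpos, hm, hρ⟩ := exists_pos_lintegral_lt_of_sigmaFinite μ one_ne_zero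
  have hmem : MemLp (fun x => ((√(ρ x : ℝ) : ℝ) : ℂ)) 2 μ := by
    refine ⟨by fun_prop, ?_⟩
    suffices eLpNorm (fun x => ((√(ρ x : ℝ) : ℝ) : ℂ)) 2 μ ^ 2 < ∞ by
      simpa using this
    rw [eLpNorm_two_sq]
    refine lt_of_le_of_lt (le_of_eq (lintegral_congr fun x => ?_)) (hρ.trans ENNReal.one_lt_top)
    rw [← ofReal_norm, ← ENNReal.ofReal_pow (norm_nonneg _), Complex.norm_real, Real.norm_eq_abs,
      sq_abs, Real.sq_sqrt (NNReal.coe_nonneg _), ENNReal.ofReal_coe_nnreal]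
  refine ⟨hmem.toLp _, ?_⟩
  filter_upwards [hmem.coeFn_toLp] with x hx
  rw [hx]
  simpa [Real.sqrt_eq_zero'] using (hpos x).ne'

theorem IsWellDefined.lintegral_enorm_sq (h : IsWellDefined μ ψ v) (f : Lp ℂ 2 μ) :
    ∫⁻ x, ‖v x * f (ψ x)‖ₑ ^ 2 ∂μ = ∫⁻ x, rnd μ ψ v x * ‖f x‖ₑ ^ 2 ∂μ := by
  have hf : Measurable fun x => ‖f x‖ₑ ^ 2 := (Lp.stronglyMeasurable f).measurable.enorm.pow_const 2
  have hfψ : Measurable fun x => ‖f (ψ x)‖ₑ ^ 2 := hf.comp h.measurable_map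
  rw [← h.lintegral_comp hf, lintegral_weightedMeasure h.measurable_weight hfψ]
  simp only [enorm_mul, mul_pow]

theorem IsWCO.enorm_sq {T : Lp ℂ 2 μ →L[ℂ] Lp ℂ 2 μ} (hT : IsWCO μ ψ v T)
    (h : IsWellDefined μ ψ v) (f : Lp ℂ 2 μ) :
    ‖T f‖ₑ ^ 2 = ∫⁻ x, rnd μ ψ v x * ‖f x‖ₑ ^ 2 ∂μ := by
  rw [Lp_enorm_sq, ← h.lintegral_enorm_sq]
  refine lintegral_congr_ae ?_
  filter_upwards [hT f] with x hx
  rw [hx]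

theorem IsWCO.rnd_le {T : Lp ℂ 2 μ →L[ℂ] Lp ℂ 2 μ} (hT : IsWCO μ ψ v T)
    (h : IsWellDefined μ ψ v) : ∀ᵐ x ∂μ, rnd μ ψ v x ≤ ‖T‖ₑ ^ 2 := by
  refine ae_le_of_forall_setLIntegral_le_of_sigmaFinite (measurable_rnd _ _ _) fun s hs hμs => ?_
  set f : Lp ℂ 2 μ := indicatorConstLp 2 hs hμs.ne 1 with hf_def
  have hf : ∀ k : X → ℝ≥0∞, ∫⁻ x, k x * ‖f x‖ₑ ^ 2 ∂μ = ∫⁻ x in s, k x ∂μ := by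
    intro k
    rw [← lintegral_indicator hs]
    refine lintegral_congr_ae ?_
    filter_upwards [indicatorConstLp_coeFn (p := 2) (hs := hs) (hμs := hμs.ne) (c := (1 : ℂ))]
      with x hx
    rw [hx]
    by_cases hxs : x ∈ s <;> simp [hxs]
  have h1 := hT.enorm_sq h f
  rw [hf] at h1
  have h2 := hf 1
  simp only [Pi.one_apply, one_mul, ← Lp_enorm_sq] at h2
  rw [← h1, lintegral_const, Measure.restrict_apply_univ, ← setLIntegral_one, ← h2, ← mul_pow]
  gcongr
  exact T.le_opENorm f

theorem IsWellDefined.exists_isWCO (h : IsWellDefined μ ψ v) {K : ℝ≥0∞} (hK : K ≠ ∞)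
    (hle : ∀ᵐ x ∂μ, rnd μ ψ v x ≤ K) : ∃ T, IsWCO μ ψ v T := by
  have bound : ∀ f : Lp ℂ 2 μ, eLpNorm (fun x => v x * f (ψ x)) 2 μ ^ 2 ≤ K * ‖f‖ₑ ^ 2 := by
    intro f
    rw [eLpNorm_two_sq, h.lintegral_enorm_sq, Lp_enorm_sq, ← lintegral_const_mul' _ _ hK]
    exact lintegral_mono_ae (hle.mono fun x hx => by gcongr)
  have hmem : ∀ f : Lp ℂ 2 μ, MemLp (fun x => v x * f (ψ x)) 2 μ := fun f => by
    refine ⟨(h.measurable_weight.mul ((Lp.stronglyMeasurable f).measurable.comp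
      h.measurable_map)).aestronglyMeasurable, ?_⟩
    have := (bound f).trans_lt (ENNReal.mul_lt_top hK.lt_top (ENNReal.pow_lt_top enorm_lt_top))
    simpa using this
  let A : Lp ℂ 2 μ →ₗ[ℂ] Lp ℂ 2 μ :=
    { toFun := fun f => MemLp.toLp _ (hmem f)
      map_add' := fun f g => by
        rw [← MemLp.toLp_add]
        exact MemLp.toLp_congr _ _ (h.add f g)
      map_smul' := fun c f => by
        rw [RingHom.id_apply, ← MemLp.toLp_const_smul]
        exact MemLp.toLp_congr _ _ (h.smul c f) }
  refine ⟨A.mkContinuous (√K.toReal) fun f => ?_, fun f => MemLp.coeFn_toLp (hmem f)⟩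
  have e : ‖A f‖ₑ ^ 2 ≤ K * ‖f‖ₑ ^ 2 := by
    have : ‖A f‖ₑ = _ := Lp.enorm_toLp (hmem f)
    rw [this]; exact bound f
  have e' := ENNReal.toReal_mono (ENNReal.mul_ne_top hK (by simp)) e
  rw [ENNReal.toReal_mul, ENNReal.toReal_pow, ENNReal.toReal_pow, toReal_enorm, toReal_enorm] at e'
  refine le_of_sq_le_sq ?_ (by positivity)
  rwa [mul_pow, Real.sq_sqrt ENNReal.toReal_nonneg]

theorem IsWCO.weight_ae_eq {v' : X → ℂ} {T : Lp ℂ 2 μ →L[ℂ] Lp ℂ 2 μ} (hT : IsWCO μ ψ v T)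
    (hT' : IsWCO μ ψ v' T) (h : IsWellDefined μ ψ v) (h' : IsWellDefined μ ψ v') : v =ᵐ[μ] v' := by
  obtain ⟨f, hf⟩ := exists_Lp_ae_ne_zero μ
  exact h.weight_ae_eq h' hf ((hT f).symm.trans (hT' f))

theorem wco_eq_iff {v' : X → ℂ} {T : Lp ℂ 2 μ →L[ℂ] Lp ℂ 2 μ} (hT : IsWCO μ ψ v T)
    (h : IsWellDefined μ ψ v) (h' : IsWellDefined μ ψ v') : wco h = wco h' ↔ v =ᵐ[μ] v' := by
  constructor
  · intro heq
    obtain ⟨f, hf⟩ := exists_Lp_ae_ne_zero μ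
    obtain ⟨hd, hv⟩ := LinearPMap.ext_iff.1 heq
    have hmem : f ∈ (wco h).domain := (memLp_congr_ae (hT f)).1 (Lp.memLp (T f))
    have hmem' : f ∈ (wco h').domain := hd ▸ hmem
    have e : MemLp.toLp _ hmem = MemLp.toLp _ hmem' := @hv f hmem hmem'
    exact h.weight_ae_eq h' hf ((MemLp.toLp_eq_toLp_iff _ _).1 e)
  · intro heq
    have key : ∀ f : Lp ℂ 2 μ, (fun x => v x * f (ψ x)) =ᵐ[μ] fun x => v' x * f (ψ x) := fun f => by
      filter_upwards [heq] with x hx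
      rw [hx]
    refine LinearPMap.ext_iff.2 ⟨?_, fun f hf hf' => ?_⟩
    · ext f
      exact memLp_congr_ae (key f)
    · exact MemLp.toLp_congr hf hf' (key f)

/-- Multiplication by an essentially bounded real function. -/
theorem exists_isWCO_id (μ : Measure X) [SigmaFinite μ] {r : X → ℝ} (hr : Measurable r) {c : ℝ}
    (hc : ∀ᵐ x ∂μ, |r x| ≤ c) : ∃ M, IsWCO μ id (fun x => (r x : ℂ)) M := by
  refine (isWellDefined_id (by fun_prop)).exists_isWCO (K := ENNReal.ofReal c ^ 2) (by simp) ?_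
  have : rnd μ id (fun x => (r x : ℂ)) =ᵐ[μ] fun x => ‖(r x : ℂ)‖ₑ ^ 2 := by
    rw [rnd, Measure.map_id, weightedMeasure]
    exact Measure.rnDeriv_withDensity _ (by fun_prop)
  filter_upwards [this, hc] with x h1 h2
  rw [h1, ← ofReal_norm, Complex.norm_real, Real.norm_eq_abs]
  gcongr

/-- The modulus of a bounded weighted composition operator is multiplication by `√h_{ψ,v}`. The
operator `N`, multiplication by the fourth root, certifies its positivity. -/
theorem IsWCO.exists_modulus {T : Lp ℂ 2 μ →L[ℂ] Lp ℂ 2 μ} (hT : IsWCO μ ψ v T)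
    (h : IsWellDefined μ ψ v) : ∃ M N : Lp ℂ 2 μ →L[ℂ] Lp ℂ 2 μ,
      IsWCO μ id (fun x => ((√(rnd μ ψ v x).toReal : ℝ) : ℂ)) M ∧ M = star N * N ∧
      ∀ f, ‖M f‖ = ‖T f‖ := by
  have hr := measurable_rnd μ ψ v
  have hle := hT.rnd_le h
  have hle' : ∀ᵐ x ∂μ, (rnd μ ψ v x).toReal ≤ ‖T‖ ^ 2 := by
    filter_upwards [hle] with x hx
    have := ENNReal.toReal_mono (by simp) hx
    simpa using this
  obtain ⟨M, hM⟩ := exists_isWCO_id μ (r := fun x => √(rnd μ ψ v x).toReal) (by fun_prop)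
    (c := √(‖T‖ ^ 2)) (hle'.mono fun x hx => by
      rw [abs_of_nonneg (Real.sqrt_nonneg _)]; gcongr)
  obtain ⟨N, hN⟩ := exists_isWCO_id μ (r := fun x => √√(rnd μ ψ v x).toReal) (by fun_prop)
    (c := √√(‖T‖ ^ 2)) (hle'.mono fun x hx => by
      rw [abs_of_nonneg (Real.sqrt_nonneg _)]; gcongr)
  refine ⟨M, N, hM, ?_, fun f => ?_⟩
  · rw [(isSelfAdjoint_of_isWCO_id hN).star_eq]
    refine hM.unique ?_
    convert hN.mul (isWellDefined_id (by fun_prop)) hN using 2 with x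
    · rfl
    rw [id_eq, ← Complex.ofReal_mul, Real.mul_self_sqrt (Real.sqrt_nonneg _)]
  · have e : ‖M f‖ₑ ^ 2 = ‖T f‖ₑ ^ 2 := by
      rw [hT.enorm_sq h, Lp_enorm_sq]
      refine lintegral_congr_ae ?_
      filter_upwards [hM f, hle] with x h1 h2
      have h2 : rnd μ ψ v x ≠ ∞ := ne_top_of_le_ne_top (by simp) h2
      rw [h1, enorm_mul, mul_pow, id_eq, ← ofReal_norm, Complex.norm_real, Real.norm_eq_abs,
        ← ENNReal.ofReal_pow (abs_nonneg _), sq_abs, Real.sq_sqrt ENNReal.toReal_nonneg,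
        ENNReal.ofReal_toReal h2]
    have e' := congrArg ENNReal.toReal e
    simp only [ENNReal.toReal_pow, toReal_enorm] at e'
    exact (sq_eq_sq₀ (norm_nonneg _) (norm_nonneg _)).1 e'

theorem IsWCO.star_mul_self {T : Lp ℂ 2 μ →L[ℂ] Lp ℂ 2 μ} (hT : IsWCO μ ψ v T)
    (h : IsWellDefined μ ψ v) :
    IsWCO μ id (fun x => ((rnd μ ψ v x).toReal : ℂ)) (star T * T) := by
  have hr := measurable_rnd μ ψ v
  obtain ⟨M, N, hM, -, hnorm⟩ := hT.exists_modulus h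
  rw [← star_mul_self_eq_of_norm_eq hnorm, (isSelfAdjoint_of_isWCO_id hM).star_eq]
  convert hM.mul (isWellDefined_id (by fun_prop)) hM using 2 with x
  · rfl
  rw [id_eq, ← Complex.ofReal_mul, Real.mul_self_sqrt ENNReal.toReal_nonneg]

/-- The phase of a bounded weighted composition operator is again a weighted composition operator,
with weight `v / √(h_{ψ,v} ∘ ψ)`. -/
theorem IsWCO.exists_phase {T : Lp ℂ 2 μ →L[ℂ] Lp ℂ 2 μ} (hT : IsWCO μ ψ v T)
    (h : IsWellDefined μ ψ v) {u : X → ℂ}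
    (hu : ∀ x, u x = v x / (√(rnd μ ψ v (ψ x)).toReal : ℝ)) (hwd : IsWellDefined μ ψ u) :
    ∃ U : Lp ℂ 2 μ →L[ℂ] Lp ℂ 2 μ, IsWCO μ ψ u U ∧ IsPhase U T := by
  have hr := measurable_rnd μ ψ v
  have hv := h.measurable_weight
  have hψ := h.measurable_map
  have hfin : ∀ᵐ x ∂μ, rnd μ ψ v x ≠ ∞ :=
    (hT.rnd_le h).mono fun x hx => ne_top_of_le_ne_top (by simp) hx
  have h0 := h.rnd_comp_ne_zero
  rw [ae_weightedMeasure_iff hv] at h0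
  have htop := h.ae hfin
  -- The derivative for the weight `u` is the indicator of the support of `h_{ψ,v}`.
  have hrnd : rnd μ ψ u =ᵐ[μ] fun x => rnd μ ψ v x * (rnd μ ψ v x)⁻¹ := by
    refine ae_eq_of_forall_lintegral_mul_eq (measurable_rnd _ _ _) (hr.mul hr.inv) fun k hk => ?_
    rw [← hwd.lintegral_comp hk, lintegral_weightedMeasure hwd.measurable_weight (by fun_prop)]
    simp only [mul_assoc]
    rw [← h.lintegral_comp (f := fun x => (rnd μ ψ v x)⁻¹ * k x) (by fun_prop),
      lintegral_weightedMeasure hv (by fun_prop)]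
    refine lintegral_congr_ae ?_
    filter_upwards [h0, htop] with x h1 h2
    by_cases hx : v x = 0
    · simp [hu, hx]
    · have hpos := ENNReal.toReal_pos (h1 hx) (h2 hx)
      rw [← mul_assoc, hu]
      congr 1
      rw [← ofReal_norm, ← ofReal_norm, norm_div, Complex.norm_real, Real.norm_eq_abs,
        abs_of_nonneg (Real.sqrt_nonneg _), ← ENNReal.ofReal_pow (by positivity), div_pow,
        Real.sq_sqrt hpos.le, ENNReal.ofReal_div_of_pos hpos, ENNReal.ofReal_toReal (h2 hx),
        ENNReal.ofReal_pow (norm_nonneg _), div_eq_mul_inv]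
  obtain ⟨U, hU⟩ := hwd.exists_isWCO (K := 1) (by simp) (hrnd.mono fun x hx => by
    rw [hx]; exact ENNReal.mul_inv_le_one _)
  obtain ⟨M, N, hM, hMN, hnorm⟩ := hT.exists_modulus h
  have hne : ∀ᵐ x ∂μ, v x ≠ 0 → ((√(rnd μ ψ v (ψ x)).toReal : ℝ) : ℂ) ≠ 0 := by
    filter_upwards [h0, htop] with x h1 h2 hx
    exact Complex.ofReal_ne_zero.2 (Real.sqrt_pos.2 (ENNReal.toReal_pos (h1 hx) (h2 hx))).ne'
  refine ⟨U, hU, isPhase_of_factorization hMN hnorm (fun f => ?_) fun f => ?_⟩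
  · rw [Lp.eq_zero_iff_ae_eq_zero, Lp.eq_zero_iff_ae_eq_zero]
    refine Filter.eventually_congr ?_
    filter_upwards [hU f, hT f, hne] with x h1 h2 h3
    rw [h1, h2, hu]
    by_cases hx : v x = 0
    · simp [hx]
    · simp [hx, h3 hx]
  · refine Lp.ext ((hT f).trans (Filter.EventuallyEq.trans ?_ (IsWCO.mul hwd hU hM f).symm))
    filter_upwards [hne] with x h1
    rw [hu]
    by_cases hx : v x = 0
    · simp [hx]
    · rw [div_mul_cancel₀ _ (h1 hx)]; rfl

end Bounded

/-! ### Equivalence of the operator-theoretic conditions -/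

section Equivalence

variable {X : Type*} [MeasurableSpace X] {μ : Measure X} [SigmaFinite μ] {φ : X → X} {w : X → ℂ}
  {C : Lp ℂ 2 μ →L[ℂ] Lp ℂ 2 μ}

theorem IsWCO.hasBoundedDerivs (hC : IsWCO μ φ w C) (h : IsWellDefined μ φ w) :
    HasBoundedDerivs μ φ w := fun n =>
  ⟨‖C ^ n‖ₑ ^ 2, by simp, (hC.pow h n).rnd_le (h.iterate n)⟩

theorem IsWCO.star_pow_mul_pow (hC : IsWCO μ φ w C) (h : IsWellDefined μ φ w) (n : ℕ) :
    IsWCO μ id (fun x => ((rndIter μ φ w n x).toReal : ℂ)) (star (C ^ n) * C ^ n) :=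
  (hC.pow h n).star_mul_self (h.iterate n)

theorem isWellDefined_id_rndIter (μ : Measure X) (φ : X → X) (w : X → ℂ) (n : ℕ) :
    IsWellDefined μ id (fun x => ((rndIter μ φ w n x).toReal : ℂ)) :=
  isWellDefined_id (Complex.measurable_ofReal.comp (measurable_rndIter μ φ w n).ennreal_toReal)

/-- Multiplication by `h_{φⁿ,w_n}` commutes with `CᵏC*ᵏ` exactly when it preserves the functions of
the form `w_k · (f ∘ φᵏ)`, that is, when `h_{φⁿ,w_n}` is a function of `φᵏ`. -/
theorem IsWCO.commute_iff (hC : IsWCO μ φ w C) (h : IsWellDefined μ φ w) (n k : ℕ) :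
    Commute (star (C ^ n) * C ^ n) (C ^ k * star (C ^ k)) ↔
      ∀ᵐ x ∂(measureIter μ φ w k),
        rndIter μ φ w n x = condEIter μ φ w k (rndIter μ φ w n) x := by
  have hb := hC.hasBoundedDerivs h
  have hDn := hC.star_pow_mul_pow h n
  have hDk := hC.star_pow_mul_pow h k
  have hmn := isWellDefined_id_rndIter μ φ w n
  have hCk := hC.pow h k
  have hk := h.iterate k
  have hrk := measurable_rndIter μ φ w k
  constructor
  · intro hcomm
    obtain ⟨f, hf⟩ := exists_Lp_ae_ne_zero μ
    set G : Lp ℂ 2 μ := (star (C ^ k) * ((star (C ^ n) * C ^ n) * C ^ k)) f with hG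
    have e : ((star (C ^ n) * C ^ n) * (C ^ k * (star (C ^ k) * C ^ k))) f = (C ^ k) G := by
      have := congrArg (fun S : Lp ℂ 2 μ →L[ℂ] Lp ℂ 2 μ => (S * C ^ k) f) hcomm.eq
      simpa only [hG, mul_assoc, mul_apply_eq_comp] using this
    have hl := hDn.mul hmn (hCk.mul hk hDk) f
    rw [e] at hl
    have hfm : Measurable f := (Lp.stronglyMeasurable f).measurable
    have hGm : Measurable G := (Lp.stronglyMeasurable G).measurable
    refine hk.condE_of_ae_eq_comp (hb.ae_ne_top k)
      (g := fun y => ENNReal.ofReal ‖G y / ((rndIter μ φ w k y).toReal * f y)‖) (by fun_prop) ?_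
    have hnz := h.ae_rndIter_comp_ne_zero k
    have hnt := h.ae_rndIter_comp_ne_top k (hb.ae_ne_top k)
    change ∀ᵐ x ∂(measureIter μ φ w k), _
    rw [h.ae_measureIter_iff] at hnz hnt ⊢
    filter_upwards [hl, hCk G, hnz, hnt, hk.ae hf, hb.ae_ne_top n] with x h1 h2 h3 h4 h5 h6 hw
    rw [h2] at h1
    have hpos := (ENNReal.toReal_pos (h3 hw) (h4 hw)).ne'
    have hposC : ((rndIter μ φ w k (φ^[k] x)).toReal : ℂ) ≠ 0 := Complex.ofReal_ne_zero.2 hpos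
    have h1 : iterWeight φ w k x * G (φ^[k] x) = (rndIter μ φ w n x).toReal *
        (iterWeight φ w k x * (rndIter μ φ w k (φ^[k] x)).toReal) * f (φ^[k] x) := h1
    have h7 : G (φ^[k] x) =
        (rndIter μ φ w n x).toReal * ((rndIter μ φ w k (φ^[k] x)).toReal * f (φ^[k] x)) :=
      mul_left_cancel₀ hw (by rw [h1]; ring)
    rw [h7, mul_div_cancel_right₀ _ (mul_ne_zero hposC (h5 hw)), Complex.norm_real,
      Real.norm_of_nonneg ENNReal.toReal_nonneg, ENNReal.ofReal_toReal h6]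
  · intro hcond
    obtain ⟨K, hK, hle⟩ := hb n
    obtain ⟨e, he, hce⟩ := exists_condE_eq_comp (μ := μ) (ψ := φ^[k]) (v := iterWeight φ w k)
      (rndIter μ φ w n)
    -- Truncation makes the multiplier bounded without changing it where it matters.
    obtain ⟨M, hM⟩ := exists_isWCO_id μ (r := fun x => (min (e x) K).toReal) (by fun_prop)
      (c := K.toReal) (ae_of_all _ fun x => by
        rw [abs_of_nonneg ENNReal.toReal_nonneg]
        exact ENNReal.toReal_mono hK (min_le_right _ _))
    refine commute_mul_star_of_intertwine (isSelfAdjoint_of_isWCO_id hDn)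
      (isSelfAdjoint_of_isWCO_id hM) ?_
    have hright : IsWCO μ (id ∘ φ^[k]) _ (C ^ k * M) := hCk.mul hk hM
    refine (hDn.mul hmn hCk).unique (hright.congr_weight ?_)
    rw [h.ae_measureIter_iff] at hcond
    filter_upwards [hcond, hle] with x h1 h2
    by_cases hw : iterWeight φ w k x = 0
    · simp [hw]
    · have h1 : rndIter μ φ w n x = e (φ^[k] x) := by
        rw [h1 hw, condEIter, hce]; rfl
      rw [← h1, min_eq_left h2, mul_comm]; rfl

theorem IsWCO.isCentered_iff (hC : IsWCO μ φ w C) (h : IsWellDefined μ φ w) :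
    IsCentered C ↔ ∀ n k : ℕ, 1 ≤ n → 1 ≤ k → ∀ᵐ x ∂(measureIter μ φ w k),
      rndIter μ φ w n x = condEIter μ φ w k (rndIter μ φ w n) x := by
  rw [WCO.isCentered_iff]
  · simp only [hC.commute_iff h]
  · intro m n
    have hm := hC.star_pow_mul_pow h m
    have hn := hC.star_pow_mul_pow h n
    refine (hm.mul (isWellDefined_id_rndIter _ _ _ _) hn).unique (IsWCO.congr_weight
      (hn.mul (isWellDefined_id_rndIter _ _ _ _) hm) (ae_of_all _ fun x => mul_comm _ _))

theorem IsWCO.exists_phase_pow (hC : IsWCO μ φ w C) (h : IsWellDefined μ φ w) (n : ℕ) :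
    ∃ U : Lp ℂ 2 μ →L[ℂ] Lp ℂ 2 μ, IsWCO μ φ^[n] (phaseWeight μ φ w n) U ∧ IsPhase U (C ^ n) :=
  (hC.pow h n).exists_phase (h.iterate n) (fun _ => rfl) (h.phaseWeight n)

theorem phaseWeight_one (μ : Measure X) (φ : X → X) (w : X → ℂ) :
    phaseWeight μ φ w 1 = fun x => w x / (√(rnd μ φ w (φ x)).toReal : ℝ) := by
  ext x
  rw [phaseWeight, iterWeight_one, rndIter_one]; rfl

theorem iterWeight_phaseWeight_one (μ : Measure X) (φ : X → X) (w : X → ℂ) (n : ℕ) :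
    iterWeight φ (phaseWeight μ φ w 1) n = powWeight μ φ w n := by
  ext x
  simp only [iterWeight, phaseWeight_one, powWeight, Function.iterate_succ_apply']

/-- The operators with the weights `w_{n,φ}` and `w_{φ,n}` are equal if and only if the weights
are. -/
theorem IsWCO.wco_phaseWeight_eq_iff (hC : IsWCO μ φ w C) (h : IsWellDefined μ φ w) (n : ℕ) :
    wco (h.phaseWeight n) = wco (h.powWeight n) ↔
      phaseWeight μ φ w n =ᵐ[μ] powWeight μ φ w n := by
  obtain ⟨U, hU, -⟩ := hC.exists_phase_pow h n
  exact wco_eq_iff hU _ _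

theorem IsWCO.isPhase_pow_iff (hC : IsWCO μ φ w C) (h : IsWellDefined μ φ w) :
    (∃ U : Lp ℂ 2 μ →L[ℂ] Lp ℂ 2 μ, IsPhase U C ∧ ∀ n : ℕ, 1 ≤ n → IsPhase (U ^ n) (C ^ n)) ↔
      ∀ n : ℕ, 1 ≤ n → phaseWeight μ φ w n =ᵐ[μ] powWeight μ φ w n := by
  obtain ⟨U, hU, hUC⟩ := hC.exists_phase_pow h 1
  rw [pow_one] at hUC
  have hpow : ∀ n, IsWCO μ φ^[n] (powWeight μ φ w n) (U ^ n) := fun n => by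
    rw [← iterWeight_phaseWeight_one]
    exact hU.pow (h.phaseWeight 1) n
  constructor
  · rintro ⟨V, hV, hVn⟩ n hn
    obtain rfl := hUC.unique hV
    obtain ⟨W, hW, hWn⟩ := hC.exists_phase_pow h n
    have hWU : W = U ^ n := hWn.unique (hVn n hn)
    exact hW.weight_ae_eq (hWU ▸ hpow n) (h.phaseWeight n) (h.powWeight n)
  · refine fun heq => ⟨U, hUC, fun n hn => ?_⟩
    obtain ⟨W, hW, hWn⟩ := hC.exists_phase_pow h n
    have hWU : W = U ^ n := (hW.congr_weight (heq n hn)).unique (hpow n)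
    exact hWU ▸ hWn

theorem IsWellDefined.phaseWeight_ae_eq_iff (h : IsWellDefined μ φ w)
    (hb : HasBoundedDerivs μ φ w) (n : ℕ) :
    WCO.phaseWeight μ φ w n =ᵐ[μ] WCO.powWeight μ φ w n ↔ ∀ᵐ x ∂(measureIter μ φ w n),
      ∏ j ∈ Finset.Icc 1 n, rnd μ φ w (φ^[j] x) = rndIter μ φ w n (φ^[n] x) := by
  rw [h.ae_measureIter_iff]
  have hz : ∀ j < n, ∀ᵐ x ∂(measureIter μ φ w n),
      rnd μ φ w (φ^[j + 1] x) ≠ 0 ∧ rnd μ φ w (φ^[j + 1] x) ≠ ∞ := fun j hj => by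
    simp only [Function.iterate_succ_apply']
    exact h.ae_measureIter_mono hj (h.ae_measureIter_comp_iterate j
      (h.rnd_comp_ne_zero.and (h.ae_comp hb.rnd_ne_top)))
  have hall : ∀ᵐ x ∂(measureIter μ φ w n), ∀ j < n,
      rnd μ φ w (φ^[j + 1] x) ≠ 0 ∧ rnd μ φ w (φ^[j + 1] x) ≠ ∞ :=
    ae_all_iff.2 fun j => Filter.eventually_imp_distrib_left.2 (hz j)
  have hnz := h.ae_rndIter_comp_ne_zero n
  have hnt := h.ae_rndIter_comp_ne_top n (hb.ae_ne_top n)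
  rw [h.ae_measureIter_iff] at hall hnz hnt
  refine Filter.eventually_congr ?_
  filter_upwards [hall, hnz, hnt] with x h1 h2 h3
  have hpow : WCO.powWeight μ φ w n x = iterWeight φ w n x /
      (√(∏ j ∈ Finset.Icc 1 n, rnd μ φ w (φ^[j] x)).toReal : ℝ) := by
    rw [WCO.powWeight, Finset.prod_div_distrib, iterWeight, prod_Icc_one_eq_prod_range,
      ENNReal.toReal_prod, Real.sqrt_prod _ fun _ _ => ENNReal.toReal_nonneg, Complex.ofReal_prod]
  rw [hpow, WCO.phaseWeight]
  by_cases hw : iterWeight φ w n x = 0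
  · simp [hw]
  have hprod : ∏ j ∈ Finset.Icc 1 n, rnd μ φ w (φ^[j] x) ≠ ∞ := by
    rw [prod_Icc_one_eq_prod_range]
    exact ENNReal.prod_ne_top fun j hj => (h1 hw j (Finset.mem_range.1 hj)).2
  rw [div_eq_mul_inv, div_eq_mul_inv, mul_right_inj' hw, inv_inj, Complex.ofReal_inj,
    Real.sqrt_inj ENNReal.toReal_nonneg ENNReal.toReal_nonneg, ENNReal.toReal_eq_toReal_iff' (h3 hw)
    hprod]
  exact ⟨fun e _ => e.symm, fun e => (e hw).symm⟩

end Equivalence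

end WCO

theorem theorem3p3 {X : Type*} [MeasurableSpace X] (μ : Measure X) [SigmaFinite μ]
    (φ : X → X) (w : X → ℂ) (hwd : WCO.IsWellDefined μ φ w)
    (C : Lp ℂ 2 μ →L[ℂ] Lp ℂ 2 μ)
    (hC : WCO.wco hwd = (C : Lp ℂ 2 μ →ₗ[ℂ] Lp ℂ 2 μ).toPMap ⊤) :
    List.TFAE [
      -- (A)
      WCO.IsCentered C,
      -- (B)
      ∀ n : ℕ, 1 ≤ n → WCO.wco (hwd.phaseWeight n) = WCO.wco (hwd.powWeight n),
      -- (B), in terms of phases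
      ∃ U : Lp ℂ 2 μ →L[ℂ] Lp ℂ 2 μ,
        WCO.IsPhase U C ∧ ∀ n : ℕ, 1 ≤ n → WCO.IsPhase (U ^ n) (C ^ n),
      -- (C)
      ∀ n : ℕ, 1 ≤ n → ∀ᵐ x ∂(WCO.measureIter μ φ w n),
        ∏ j ∈ Finset.Icc 1 n, WCO.rnd μ φ w (φ^[j] x) = WCO.rndIter μ φ w n (φ^[n] x),
      -- (D)
      ∀ n : ℕ, 1 ≤ n → ∀ᵐ x ∂(WCO.weightedMeasure μ w),
        WCO.rndIter μ φ w n x = WCO.condE μ φ w (WCO.rndIter μ φ w n) x,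
      -- (E)
      ∀ n : ℕ, 1 ≤ n → ∀ᵐ x ∂(WCO.weightedMeasure μ w),
        WCO.rndIter μ φ w (n + 1) (φ x) = WCO.rndIter μ φ w n x * WCO.rnd μ φ w (φ x),
      -- (F)
      ∀ n : ℕ, 1 ≤ n → ∀ᵐ x ∂(WCO.measureIter μ φ w n),
        WCO.rnd μ φ w x = WCO.condEIter μ φ w n (WCO.rnd μ φ w) x,
      -- (G)
      ∀ n : ℕ, 1 ≤ n → ∀ᵐ x ∂(WCO.measureIter μ φ w (n + 1)),
        WCO.condEIter μ φ w n (WCO.rnd μ φ w) (φ x) =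
          WCO.condEIter μ φ w (n + 1) (fun y => WCO.rnd μ φ w (φ y)) x,
      -- (H)
      ∀ n k : ℕ, 1 ≤ n → 1 ≤ k → ∀ᵐ x ∂(WCO.measureIter μ φ w k),
        WCO.rndIter μ φ w n x = WCO.condEIter μ φ w k (WCO.rndIter μ φ w n) x] := by
  have hop : WCO.IsWCO μ φ w C := WCO.isWCO_of_wco_eq hC
  have hb := hop.hasBoundedDerivs hwd
  have hweights := hop.isPhase_pow_iff hwd
  simp only [hwd.phaseWeight_ae_eq_iff hb] at hweights
  tfae_have 1 ↔ 9 := hop.isCentered_iff hwd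
  tfae_have 2 ↔ 4 := by
    simp only [hop.wco_phaseWeight_eq_iff hwd, hwd.phaseWeight_ae_eq_iff hb]
  tfae_have 3 ↔ 4 := hweights
  tfae_have 5 ↔ 6 := forall₂_congr fun n _ => hwd.eq_condE_iff hb n
  tfae_have 6 → 9 := hwd.eq_condEIter_rndIter hb
  tfae_have 9 → 7 := fun h n hn => by
    simpa only [WCO.rndIter_one] using h 1 n le_rfl hn
  tfae_have 7 → 4 := hwd.prod_rnd_eq hb
  tfae_have 4 → 5 := hwd.eq_condE_of_prod_rnd_eq hb
  tfae_have 7 → 8 := fun h n hn => hwd.condEIter_comp_eq hb n (h n hn)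
  tfae_have 8 → 7 := fun h n hn => hwd.eq_condEIter_of_comp_eq hb n (h n hn)
  tfae_finish
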